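/- For $n\ge 1$ let $\mathrm{Conv}_c(\mathbb{R}^n)$ be the set of convex, lower semicontinuous functions $\psi\colon\mathbb{R}^n\to(-\infty,\infty]$ that are proper ($\psi\not\equiv\infty$) and coercive ($\lim_{|x|\to\infty}\psi(x)=\infty$). For $\psi,\psi_1,\psi_2\in\mathrm{Conv}_c(\mathbb{R}^n)$ and $\lambda>0$ put $$(\psi_1\,\square\,\psi_2)(x)=\inf_{y\in\mathbb{R}^n}\big(\psi_1(x-y)+\psi_2(y)\big),\qquad (\lambda\cdot\psi)(x)=\lambda\,\psi(x/\lambda),\qquad \psi^-(x)=\psi(-x),\qquad \mathcal{L}\psi(x)=\sup_{y\in\mathbb{R}^n}\big(\langle x,y\rangle-\psi(y)\big);$$ the functions $\psi_1\square\psi_2$, $\lambda\cdot\psi$, $\psi^-$ again belong to $\mathrm{Conv}_c(\mathbb{R}^n)$. A sequence of functions $\psi_j$ epi-converges to $\psi$ if for every $x\in\mathbb{R}^n$ one has $\psi(x)\le\liminf_j\psi_j(x_j)$ for every sequence $x_j\to x$, and $\psi(x)=\lim_j\psi_j(x_j)$ for some sequence $x_j\to x$. Let $\Psi$ be a functional on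 $\mathrm{Conv}_c(\mathbb{R}^n)$ with values either in $(-\infty,\infty]$ or in $[-\infty,\infty)$. It is called convex if $\Psi\big(\lambda\cdot\psi_1\,\square\,(1-\lambda)\cdot\psi_2\big)\le\lambda\Psi(\psi_1)+(1-\lambda)\Psi(\psi_2)$ for all $\psi_1,\psi_2\in\mathrm{Conv}_c(\mathbb{R}^n)$ and $\lambda\in(0,1)$; lower semicontinuous if $\Psi(\psi)\le\liminf_j\Psi(\psi_j)$ whenever $\psi_j\in\mathrm{Conv}_c(\mathbb{R}^n)$ epi-converges to $\psi\in\mathrm{Conv}_c(\mathbb{R}^n)$; invariant under rotations if $\Psi(\psi\circ\vartheta^{-1})=\Psi(\psi)$ for all $\psi$ and all $\vartheta\in\mathrm{SO}(n)$; invariant under reflections if $\Psi(\psi^-)=\Psi(\psi)$ for all $\psi$. **Theorem.** (a) Let $n\ge 2$. For every $\psi\in\mathrm{Conv}_c(\mathbb{R}^n)$ there is a unique $\psi_{\rm rot}\in\mathrm{Conv}_c(\mathbb{R}^n)$ with $$\mathcal{L}\psi_{\rm rot}(x)=\int_{\mathrm{SO}(n)}\mathcal{L}\psi(\vartheta^{-1}x)\,\mathrm{d}\vartheta\qquad\text{for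 all }x\in\mathbb{R}^n,$$ where $\mathrm{d}\vartheta$ is the Haar probability measure on $\mathrm{SO}(n)$. If $\Psi$ is lower semicontinuous, convex and invariant under rotations, then $\Psi(\psi)\ge\Psi(\psi_{\rm rot})$ for every $\psi\in\mathrm{Conv}_c(\mathbb{R}^n)$. (b) Let $n=1$ and $\psi_{\rm rot}=\tfrac12\cdot(\psi\,\square\,\psi^-)$. If $\Psi$ is convex and invariant under reflections, then $\Psi(\psi)\ge\Psi(\psi_{\rm rot})$ for every $\psi\in\mathrm{Conv}_c(\mathbb{R})$. -/

import Mathlib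

open MeasureTheory Filter Topology

/-! ### Coercive convex functions on `ℝⁿ` -/

/-- The set of coercive, proper, lower semicontinuous, convex functions `ψ : ℝⁿ → (-∞, ∞]`. -/
@[ext]
structure ConvC (n : ℕ) where
  /-- the underlying extended-real-valued function -/
  toFun : EuclideanSpace ℝ (Fin n) → EReal
  ne_bot' : ∀ x, toFun x ≠ ⊥
  convex' : ∀ x y : EuclideanSpace ℝ (Fin n), ∀ t : ℝ, 0 < t → t < 1 →
    toFun (t • x + (1 - t) • y) ≤ (t : EReal) * toFun x + ((1 - t : ℝ) : EReal) * toFun y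
  coercive' : Tendsto toFun (Bornology.cobounded (EuclideanSpace ℝ (Fin n))) (𝓝 ⊤)
  proper' : ∃ x, toFun x < ⊤
  lsc' : LowerSemicontinuous toFun

instance (n : ℕ) : CoeFun (ConvC n) (fun _ => EuclideanSpace ℝ (Fin n) → EReal) :=
  ⟨ConvC.toFun⟩

/-- The infimal convolution (epi-sum) `(f □ g)(x) = inf_y (f (x - y) + g y)`. -/
noncomputable def infConv {n : ℕ} (f g : EuclideanSpace ℝ (Fin n) → EReal) :
    EuclideanSpace ℝ (Fin n) → EReal :=
  fun x => ⨅ y, (f (x - y) + g y)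

namespace ConvC

variable {n : ℕ}

/-- A coercive lower semicontinuous function attains its infimum. -/
theorem exists_forall_le_of_coercive {g : EuclideanSpace ℝ (Fin n) → EReal}
    (hl : LowerSemicontinuous g)
    (hc : Tendsto g (Bornology.cobounded (EuclideanSpace ℝ (Fin n))) (𝓝 ⊤)) :
    ∃ y, ∀ z, g y ≤ g z := by
  by_cases h : ∃ y, g y < ⊤
  · obtain ⟨y₀, hy₀⟩ := h
    have hev := hc.eventually (lt_mem_nhds hy₀)

    have hb : Bornology.IsBounded {z | g y₀ < g z}ᶜ := Bornology.isBounded_compl_iff.2 hev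
    obtain ⟨R, hR⟩ := hb.subset_closedBall 0
    have hy₀R : y₀ ∈ Metric.closedBall (0 : EuclideanSpace ℝ (Fin n)) R :=
      hR (by simp)
    obtain ⟨a, -, hmin⟩ := LowerSemicontinuousOn.exists_isMinOn ⟨y₀, hy₀R⟩
      (isCompact_closedBall 0 R) (hl.lowerSemicontinuousOn _)
    refine ⟨a, fun z => ?_⟩
    by_cases hz : g y₀ < g z
    · exact (hmin hy₀R).trans hz.le
    · exact hmin (hR hz)
  · push Not at h
    exact ⟨0, fun z => le_top.trans (h z)⟩

/-- Elements of `ConvC n` are bounded from below by a real number. -/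
theorem exists_real_le (ψ : ConvC n) : ∃ m : ℝ, ∀ x, (m : EReal) ≤ ψ x := by
  obtain ⟨y, hy⟩ := exists_forall_le_of_coercive ψ.lsc' ψ.coercive'
  obtain ⟨x, hx⟩ := ψ.proper'
  refine ⟨(ψ y).toReal, fun z => ?_⟩
  rw [EReal.coe_toReal ((hy x).trans_lt hx).ne (ψ.ne_bot' y)]
  exact hy z

theorem add_continuousAt (ψ₁ ψ₂ : ConvC n) (x y : EuclideanSpace ℝ (Fin n)) :
    ContinuousAt (fun p : EReal × EReal => p.1 + p.2) (ψ₁ x, ψ₂ y) :=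
  EReal.continuousAt_add (Or.inr (ψ₂.ne_bot' y)) (Or.inl (ψ₁.ne_bot' x))

theorem lsc_infConv_integrand (ψ₁ ψ₂ : ConvC n) :
    LowerSemicontinuous (fun p : EuclideanSpace ℝ (Fin n) × EuclideanSpace ℝ (Fin n) =>
      ψ₁ (p.1 - p.2) + ψ₂ p.2) :=
  LowerSemicontinuous.add' (LowerSemicontinuous.comp ψ₁.lsc' (by fun_prop))
    (LowerSemicontinuous.comp ψ₂.lsc' (by fun_prop)) fun _ => add_continuousAt ψ₁ ψ₂ _ _

theorem coercive_infConv_integrand (ψ₁ ψ₂ : ConvC n) (a : EReal) (ha : a < ⊤) :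
    ∀ᶠ y in Bornology.cobounded (EuclideanSpace ℝ (Fin n)), ∀ x, a < ψ₁ (x - y) + ψ₂ y := by
  obtain ⟨m, hm⟩ := ψ₁.exists_real_le
  have h : a - m < ⊤ := by
    induction a <;> simp_all [← EReal.coe_sub, EReal.coe_lt_top]
  filter_upwards [ψ₂.coercive'.eventually (lt_mem_nhds h)] with y hy x
  calc a = m + (a - m) := by
        induction a
        · simp
        · rw [← EReal.coe_sub, ← EReal.coe_add]; congr 1; ring
        · simp at ha
    _ < m + ψ₂ y := EReal.add_lt_add_left_coe hy m
    _ ≤ ψ₁ (x - y) + ψ₂ y := by gcongr; exact hm _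

theorem infConv_attained (ψ₁ ψ₂ : ConvC n) (x : EuclideanSpace ℝ (Fin n)) :
    ∃ y, infConv ψ₁ ψ₂ x = ψ₁ (x - y) + ψ₂ y := by
  obtain ⟨y, hy⟩ := exists_forall_le_of_coercive (g := fun y => ψ₁ (x - y) + ψ₂ y)
    (LowerSemicontinuous.comp (lsc_infConv_integrand ψ₁ ψ₂) (g := fun y => (x, y)) (by fun_prop))
    (EReal.tendsto_nhds_top_iff_real.2 fun a =>
      (coercive_infConv_integrand ψ₁ ψ₂ a (EReal.coe_lt_top a)).mono fun y h => h x)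
  exact ⟨y, le_antisymm (iInf_le _ y) (le_iInf hy)⟩

/-- The epi-sum `ψ₁ □ ψ₂` as an element of `ConvC n`. -/
noncomputable def epiSum (ψ₁ ψ₂ : ConvC n) : ConvC n where
  toFun := infConv ψ₁ ψ₂
  ne_bot' x := by
    obtain ⟨y, hy⟩ := infConv_attained ψ₁ ψ₂ x
    rw [hy]
    exact EReal.add_ne_bot_iff.2 ⟨ψ₁.ne_bot' _, ψ₂.ne_bot' _⟩
  convex' x x' t h0 h1 := by
    obtain ⟨y, hy⟩ := infConv_attained ψ₁ ψ₂ x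
    obtain ⟨y', hy'⟩ := infConv_attained ψ₁ ψ₂ x'
    have ht : (0 : EReal) ≤ (t : EReal) := EReal.coe_nonneg.2 h0.le
    have ht' : (0 : EReal) ≤ ((1 - t : ℝ) : EReal) := EReal.coe_nonneg.2 (by linarith)
    rw [hy, hy', EReal.left_distrib_of_nonneg_of_ne_top ht (EReal.coe_ne_top _),
      EReal.left_distrib_of_nonneg_of_ne_top ht' (EReal.coe_ne_top _)]
    refine (iInf_le _ (t • y + (1 - t) • y')).trans ?_
    have e : t • x + (1 - t) • x' - (t • y + (1 - t) • y')
        = t • (x - y) + (1 - t) • (x' - y') := by module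
    rw [e]
    exact (add_le_add (ψ₁.convex' _ _ t h0 h1) (ψ₂.convex' _ _ t h0 h1)).trans_eq
      (add_add_add_comm _ _ _ _)
  coercive' := by
    rw [EReal.tendsto_nhds_top_iff_real]
    intro a
    obtain ⟨m, hm⟩ := ψ₂.exists_real_le
    have hb := Bornology.isBounded_compl_iff.2
      (coercive_infConv_integrand ψ₁ ψ₂ a (EReal.coe_lt_top a))
    have hb' := Bornology.isBounded_compl_iff.2
      (ψ₁.coercive'.eventually (lt_mem_nhds (EReal.coe_lt_top (a - m))))
    have hs := Bornology.isBounded_def.1 (hb'.add hb)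
    filter_upwards [hs] with x hx
    obtain ⟨y, hy⟩ := infConv_attained ψ₁ ψ₂ x
    rw [hy]
    by_contra hcon
    refine hx (Set.mem_add.2 ⟨x - y, fun h => hcon ?_, y, fun h => hcon (h x), by abel⟩)
    calc (a : EReal) = ((a - m : ℝ) : EReal) + m := by
          rw [← EReal.coe_add]; congr 1; ring
      _ < ψ₁ (x - y) + m := EReal.add_lt_add_right_coe h m
      _ ≤ ψ₁ (x - y) + ψ₂ y := by gcongr; exact hm _
  proper' := by
    obtain ⟨x, hx⟩ := ψ₁.proper'
    obtain ⟨y, hy⟩ := ψ₂.proper'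
    refine ⟨x + y, (iInf_le _ y).trans_lt ?_⟩
    rw [add_sub_cancel_right]
    exact EReal.add_lt_top hx.ne hy.ne
  lsc' := by
    intro x₀ a ha
    have ha' : a < ⊤ := ha.trans_le le_top
    have hb := Bornology.isBounded_compl_iff.2
      (coercive_infConv_integrand ψ₁ ψ₂ a ha')
    obtain ⟨R, hR⟩ := hb.subset_closedBall 0
    have hK := (isCompact_closedBall (0 : EuclideanSpace ℝ (Fin n)) R
      ).eventually_forall_of_forall_eventually (x₀ := x₀)
      (P := fun x y => a < ψ₁ (x - y) + ψ₂ y)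
      (fun y _ => lsc_infConv_integrand ψ₁ ψ₂ (x₀, y) a (ha.trans_le (iInf_le _ y)))
    filter_upwards [hK] with x hx
    obtain ⟨y, hy⟩ := infConv_attained ψ₁ ψ₂ x
    rw [hy]
    by_cases hyK : y ∈ Metric.closedBall (0 : EuclideanSpace ℝ (Fin n)) R
    · exact hx y hyK
    · by_contra hcon
      exact hyK (hR fun h => hcon (h x))

/-- Composition of a function in `ConvC n` with an invertible linear map. -/
def compEquiv (ψ : ConvC n) (L : EuclideanSpace ℝ (Fin n) ≃L[ℝ] EuclideanSpace ℝ (Fin n)) :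
    ConvC n where
  toFun x := ψ (L x)
  ne_bot' x := ψ.ne_bot' _
  convex' x y t h0 h1 := by
    simpa only [map_add, map_smul] using ψ.convex' (L x) (L y) t h0 h1
  coercive' := ψ.coercive'.comp L.antilipschitz.tendsto_cobounded
  proper' := by
    obtain ⟨x, hx⟩ := ψ.proper'
    exact ⟨L.symm x, by simpa using hx⟩
  lsc' := LowerSemicontinuous.comp ψ.lsc' L.continuous

theorem continuous_coe_mul (c : ℝ) : Continuous fun a : EReal => (c : EReal) * a :=
  continuous_iff_continuousAt.2 fun _ =>
    EReal.Tendsto.const_mul tendsto_id (Or.inl (EReal.coe_ne_bot c))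
      (Or.inl (EReal.coe_ne_top c))

/-- The epi-multiplication `(c ⬝ ψ)(x) = c ψ(x / c)` for `c > 0`. -/
noncomputable def epiMul (c : ℝ) (hc : 0 < c) (ψ : ConvC n) : ConvC n where
  toFun x := (c : EReal) * ψ (c⁻¹ • x)
  ne_bot' x := by
    have := ψ.ne_bot' (c⁻¹ • x)
    have hc' : (0 : EReal) ≤ (c : EReal) := EReal.coe_nonneg.2 hc.le
    rw [EReal.mul_ne_bot]
    simp [this, EReal.coe_ne_bot, EReal.coe_ne_top, hc']
  convex' x y t h0 h1 := by
    have hc' : (0 : EReal) ≤ (c : EReal) := EReal.coe_nonneg.2 hc.le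
    have e : c⁻¹ • (t • x + (1 - t) • y) = t • (c⁻¹ • x) + (1 - t) • (c⁻¹ • y) := by module
    rw [e]
    refine (mul_le_mul_of_nonneg_left (ψ.convex' _ _ t h0 h1) hc').trans_eq ?_
    rw [EReal.left_distrib_of_nonneg_of_ne_top hc' (EReal.coe_ne_top _),
      mul_left_comm, mul_left_comm (c : EReal)]
  coercive' := by
    have h1 : Tendsto (fun x : EuclideanSpace ℝ (Fin n) => c⁻¹ • x)
        (Bornology.cobounded _) (Bornology.cobounded _) :=
      (ContinuousLinearEquiv.smulLeft (R₁ := ℝ) (M₁ := EuclideanSpace ℝ (Fin n))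
        (Units.mk0 c⁻¹ (inv_pos.2 hc).ne')).antilipschitz.tendsto_cobounded
    have h2 := (continuous_coe_mul c).tendsto ⊤
    rw [EReal.coe_mul_top_of_pos hc] at h2
    exact h2.comp (ψ.coercive'.comp h1)
  proper' := by
    obtain ⟨x, hx⟩ := ψ.proper'
    refine ⟨c • x, ?_⟩
    rw [inv_smul_smul₀ hc.ne', ← EReal.coe_toReal hx.ne (ψ.ne_bot' x), ← EReal.coe_mul]
    exact EReal.coe_lt_top _
  lsc' := (continuous_coe_mul c).comp_lowerSemicontinuous
    (LowerSemicontinuous.comp ψ.lsc' (g := fun x => c⁻¹ • x) (by fun_prop))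
    (fun _ _ h => mul_le_mul_of_nonneg_left h (EReal.coe_nonneg.2 hc.le))

/-- The reflection `ψ⁻(x) = ψ(-x)`. -/
def reflect (ψ : ConvC n) : ConvC n :=
  ψ.compEquiv (ContinuousLinearEquiv.neg ℝ)

end ConvC

/-! ### Rotations and the Haar probability measure -/

/-- The rotation group `SO(n)`, with the topology inherited from the space of matrices. -/
abbrev SO (n : ℕ) := Matrix.specialOrthogonalGroup (Fin n) ℝ

namespace SO

variable {n : ℕ}

theorem coe_inv (A : SO n) : ((A⁻¹ : SO n) : Matrix (Fin n) (Fin n) ℝ) = A.1.transpose := rfl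

instance : IsTopologicalGroup (SO n) where
  continuous_inv := by
    refine Continuous.subtype_mk (?_ : Continuous fun A : SO n => A.1.transpose) _
    exact continuous_subtype_val.matrix_transpose

instance : CompactSpace (SO n) := by
  refine isCompact_iff_compactSpace.1
    (?_ : IsCompact (Matrix.specialOrthogonalGroup (Fin n) ℝ : Set (Matrix (Fin n) (Fin n) ℝ)))
  have hK : IsCompact (Set.univ.pi fun _ : Fin n => Set.univ.pi fun _ : Fin n =>
      Set.Icc (-1 : ℝ) 1) :=
    isCompact_univ_pi fun _ => isCompact_univ_pi fun _ => isCompact_Icc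
  have hcl : IsClosed {A : Matrix (Fin n) (Fin n) ℝ | A * A.transpose = 1 ∧ A.det = 1} :=
    (isClosed_eq (by fun_prop) continuous_const).inter (isClosed_eq (by fun_prop) continuous_const)
  have he : (Matrix.specialOrthogonalGroup (Fin n) ℝ : Set (Matrix (Fin n) (Fin n) ℝ))
      = {A | A * A.transpose = 1 ∧ A.det = 1} := by
    ext A
    exact Matrix.mem_specialOrthogonalGroup_iff.trans
      (and_congr_left' (Matrix.mem_orthogonalGroup_iff _ _))
  refine IsCompact.of_isClosed_subset hK (he ▸ hcl) ?_
  rw [he]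
  rintro A ⟨hA, -⟩ i - j -
  have h1 : ∑ k, A i k * A i k = 1 := by
    simpa [Matrix.mul_apply] using congrFun (congrFun hA i) i
  have h2 : A i j * A i j ≤ ∑ k, A i k * A i k :=
    Finset.single_le_sum (f := fun k => A i k * A i k)
      (fun k _ => mul_self_nonneg _) (Finset.mem_univ j)
  exact abs_le.1 (abs_le_one_iff_mul_self_le_one.2 (h2.trans h1.le))

instance : MeasurableSpace (SO n) := borel _

instance : BorelSpace (SO n) := ⟨rfl⟩

/-- The Haar probability measure on `SO(n)`. -/
noncomputable def haar (n : ℕ) : Measure (SO n) := Measure.haarMeasure ⊤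

theorem haar_univ : haar n Set.univ = 1 := Measure.haarMeasure_self (K₀ := ⊤)

instance : IsProbabilityMeasure (haar n) := ⟨haar_univ⟩

/-- The action of a rotation on `ℝⁿ` by matrix-vector multiplication. -/
noncomputable def act (A : SO n) : EuclideanSpace ℝ (Fin n) ≃L[ℝ] EuclideanSpace ℝ (Fin n) :=
  LinearEquiv.toContinuousLinearEquiv
    { Matrix.toEuclideanLin A.1 with
      invFun := Matrix.toEuclideanLin (A⁻¹ : SO n).1
      left_inv := fun x => by
        have h : (A⁻¹ : SO n).1 * A.1 = 1 := congrArg Subtype.val (inv_mul_cancel A)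
        change Matrix.toEuclideanLin (A⁻¹ : SO n).1 (Matrix.toEuclideanLin A.1 x) = x
        rw [← LinearMap.comp_apply, ← Matrix.toLpLin_mul, h]
        simp
      right_inv := fun x => by
        have h : A.1 * (A⁻¹ : SO n).1 = 1 := congrArg Subtype.val (mul_inv_cancel A)
        change Matrix.toEuclideanLin A.1 (Matrix.toEuclideanLin (A⁻¹ : SO n).1 x) = x
        rw [← LinearMap.comp_apply, ← Matrix.toLpLin_mul, h]
        simp }

theorem act_apply (A : SO n) (x : EuclideanSpace ℝ (Fin n)) :
    act A x = WithLp.toLp 2 (A.1.mulVec x.ofLp) := rfl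

end SO

/-- The rotated function `ψ ∘ ϑ⁻¹`. -/
noncomputable def ConvC.rotate {n : ℕ} (ϑ : SO n) (ψ : ConvC n) : ConvC n :=
  ψ.compEquiv (SO.act ϑ⁻¹)

/-! ### The Legendre transform and the rotational epi-symmetrization -/

/-- The convex conjugate `(ℒ ψ)(x) = sup_y (⟨x, y⟩ - ψ y)`. -/
noncomputable def legendre {n : ℕ} (ψ : EuclideanSpace ℝ (Fin n) → EReal) :
    EuclideanSpace ℝ (Fin n) → EReal :=
  fun x => ⨆ y, (((inner ℝ x y : ℝ) : EReal) - ψ y)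

/-- The integral of an extended-real-valued function: the integral of the positive part minus
the integral of the negative part (meaningful as soon as one of the two is finite). -/
noncomputable def erealIntegral {Ω : Type*} [MeasurableSpace Ω] (μ : Measure Ω)
    (f : Ω → EReal) : EReal :=
  ((∫⁻ ω, (f ω).toENNReal ∂μ : ENNReal) : EReal) - ((∫⁻ ω, (-f ω).toENNReal ∂μ : ENNReal) : EReal)

/-- `φ` is the rotational epi-symmetrization of `ψ` (in dimension `n ≥ 2`): its conjugate is the
average of the conjugate of `ψ` over all rotations. -/
def IsRotEpiSymmetrization {n : ℕ} (ψ φ : ConvC n) : Prop :=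
  ∀ x, legendre φ x = erealIntegral (SO.haar n) fun ϑ => legendre ψ (SO.act ϑ⁻¹ x)

/-- The rotational epi-symmetrization `½ ⬝ (ψ □ ψ⁻)` in dimension one. -/
noncomputable def ConvC.rotOne (ψ : ConvC 1) : ConvC 1 :=
  (ψ.epiSum ψ.reflect).epiMul (1 / 2) (by norm_num)

/-! ### Functionals on coercive convex functions -/

/-- Epi-convergence of a sequence of extended-real-valued functions. -/
def EpiConverges {n : ℕ} (f : ℕ → EuclideanSpace ℝ (Fin n) → EReal)
    (g : EuclideanSpace ℝ (Fin n) → EReal) : Prop :=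
  ∀ x, (∀ u : ℕ → EuclideanSpace ℝ (Fin n), Tendsto u atTop (𝓝 x) →
      g x ≤ liminf (fun j => f j (u j)) atTop) ∧
    ∃ u : ℕ → EuclideanSpace ℝ (Fin n), Tendsto u atTop (𝓝 x) ∧
      Tendsto (fun j => f j (u j)) atTop (𝓝 (g x))

namespace ConvC

variable {n : ℕ}

/-- `Ψ` takes its values in `(-∞, ∞]`, or it takes its values in `[-∞, ∞)`. -/
def IsAdmissible (Ψ : ConvC n → EReal) : Prop :=
  (∀ ψ, Ψ ψ ≠ ⊥) ∨ (∀ ψ, Ψ ψ ≠ ⊤)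

/-- Convexity of a functional with respect to infimal convolution. -/
def IsConvexFunctional (Ψ : ConvC n → EReal) : Prop :=
  ∀ (ψ₁ ψ₂ : ConvC n) (t : ℝ) (h0 : 0 < t) (h1 : t < 1),
    Ψ ((ψ₁.epiMul t h0).epiSum (ψ₂.epiMul (1 - t) (sub_pos.2 h1))) ≤
      (t : EReal) * Ψ ψ₁ + ((1 - t : ℝ) : EReal) * Ψ ψ₂

/-- Lower semicontinuity of a functional with respect to epi-convergence. -/
def IsEpiLowerSemicontinuous (Ψ : ConvC n → EReal) : Prop :=
  ∀ (ψs : ℕ → ConvC n) (ψ : ConvC n), EpiConverges (fun j => ψs j) ψ →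
    Ψ ψ ≤ liminf (fun j => Ψ (ψs j)) atTop

/-- Invariance under rotations. -/
def IsRotationInvariant (Ψ : ConvC n → EReal) : Prop :=
  ∀ (ψ : ConvC n) (ϑ : SO n), Ψ (ψ.rotate ϑ) = Ψ ψ

/-- Invariance under reflections. -/
def IsReflectionInvariant (Ψ : ConvC n → EReal) : Prop :=
  ∀ ψ : ConvC n, Ψ ψ.reflect = Ψ ψ

end ConvC

/-! Conjugation turns epi-averages into arithmetic means. The mean of `ℒ ψ` over all rotations is
therefore a limit of conjugates of epi-averages of rotated copies of `ψ`. Convexity and rotation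
invariance bound `Ψ` on each such epi-average by `Ψ ψ`, and lower semicontinuity carries the bound
to the limit. In dimension one, `ψ_rot` is itself the epi-average of `ψ` and `ψ⁻`
(`ConvC.rotOne_eq`), so no limit is needed.

The rotations are sampled independently from Haar measure, and the strong law is applied to
countably many functions at once (`exists_seq_tendsto_average`). Since `ℒ ψ` may be infinite, two
families are used. Values of `ℒ ψ` at countably many slopes where `ℒ ψ_rot` is finite already
generate `ψ_rot` as a supremum of affine functions; they give the liminf inequality. Finite maxima
of affine functions increasing to `ℒ ψ` are Lipschitz; they give lower bounds for the conjugates,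
uniform near each slope, and separation turns these into recovery sequences
(`epiConverges_of_conjugate`).

Existence uses the same maxima: by monotone convergence the averaged conjugate is a supremum of
finite continuous convex functions. Linear growth of `ψ` bounds it near the origin, which makes its
own conjugate coercive. Fenchel–Moreau shows that this conjugate is `ψ_rot`, and also gives
uniqueness. -/

/-! ### Affine minorants and convex duality -/

theorem EReal.coe_le_of_forall_coe {v : ℝ} {y : EReal} (h : ∀ r : ℝ, y ≤ r → v ≤ r) :
    (v : EReal) ≤ y := by
  induction y with
  | bot => exact absurd (h (v - 1) bot_le) (by linarith)
  | coe y => exact EReal.coe_le_coe_iff.2 (h y le_rfl)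
  | top => exact le_top

theorem EReal.coe_sub_le_coe_iff {a c : ℝ} {y : EReal} :
    (a : EReal) - y ≤ c ↔ ((a - c : ℝ) : EReal) ≤ y := by
  induction y with
  | bot => simp [-EReal.coe_sub]
  | coe y =>
    rw [← EReal.coe_sub, EReal.coe_le_coe_iff, EReal.coe_le_coe_iff]
    constructor <;> intro h <;> linarith
  | top => simp

/-- A convex lower semicontinuous function with an affine minorant is the supremum of its
affine minorants. -/
theorem exists_affine_minorant_gt {n : ℕ} {f : EuclideanSpace ℝ (Fin n) → EReal}
    (hconv : ∀ x y : EuclideanSpace ℝ (Fin n), ∀ t : ℝ, 0 < t → t < 1 →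
      f (t • x + (1 - t) • y) ≤ (t : EReal) * f x + ((1 - t : ℝ) : EReal) * f y)
    (hlsc : LowerSemicontinuous f)
    (hmin : ∃ (p : EuclideanSpace ℝ (Fin n)) (c : ℝ), ∀ x, ((inner ℝ p x + c : ℝ) : EReal) ≤ f x)
    {x₀ : EuclideanSpace ℝ (Fin n)} {a : ℝ} (ha : (a : EReal) < f x₀) :
    ∃ (p : EuclideanSpace ℝ (Fin n)) (c : ℝ),
      (∀ x, ((inner ℝ p x + c : ℝ) : EReal) ≤ f x) ∧ a < inner ℝ p x₀ + c := by
  set S : Set (EuclideanSpace ℝ (Fin n) × ℝ) := {q | f q.1 ≤ (q.2 : EReal)} with hS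
  have hScl : IsClosed S :=
    hlsc.isClosed_epigraph.preimage
      (f := fun q : EuclideanSpace ℝ (Fin n) × ℝ => (q.1, (q.2 : EReal)))
      (continuous_fst.prodMk (continuous_coe_real_ereal.comp continuous_snd))
  have hScv : Convex ℝ S := by
    rw [convex_iff_forall_pos]
    rintro ⟨x, r⟩ hx ⟨y, s⟩ hy t t' ht ht' htt
    obtain rfl : t' = 1 - t := by linarith
    have hx' : f x ≤ (r : EReal) := hx
    have hy' : f y ≤ (s : EReal) := hy
    change f (t • x + (1 - t) • y) ≤ ((t * r + (1 - t) * s : ℝ) : EReal)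
    refine (hconv x y t ht (by linarith)).trans ?_
    rw [EReal.coe_add, EReal.coe_mul, EReal.coe_mul]
    exact add_le_add (mul_le_mul_of_nonneg_left hx' (EReal.coe_nonneg.2 ht.le))
      (mul_le_mul_of_nonneg_left hy' (EReal.coe_nonneg.2 ht'.le))
  have hnot : (x₀, a) ∉ S := fun h => absurd ha (not_lt.2 h)
  obtain ⟨φ, u, hφ, hu⟩ := geometric_hahn_banach_closed_point hScv hScl hnot
  set p₀ : EuclideanSpace ℝ (Fin n) := (InnerProductSpace.toDual ℝ _).symm
    (φ.comp (ContinuousLinearMap.inl ℝ _ ℝ)) with hp₀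
  set s : ℝ := φ (0, 1) with hs
  have key : ∀ x (r : ℝ), φ (x, r) = inner ℝ p₀ x + s * r := by
    intro x r
    have h1 : (x, r) = (x, (0 : ℝ)) + r • ((0 : EuclideanSpace ℝ (Fin n)), (1 : ℝ)) := by
      ext <;> simp
    rw [h1, map_add, map_smul, hp₀, InnerProductSpace.toDual_symm_apply, hs, smul_eq_mul, mul_comm r]
    rfl
  rw [key] at hu
  have hφ' : ∀ x (r : ℝ), f x ≤ r → inner ℝ p₀ x + s * r < u := fun x r h => key x r ▸ hφ (x, r) h
  -- If `s < 0`, the separating hyperplane is the graph of an affine function.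
  rcases lt_or_ge s 0 with hs0 | hs0
  · refine ⟨(-s)⁻¹ • p₀, -((-s)⁻¹ * u), fun x => EReal.coe_le_of_forall_coe fun r hr => ?_, ?_⟩
    · have h := hφ' x r hr
      rw [real_inner_smul_left, ← mul_neg, ← mul_add, inv_mul_le_iff₀ (by linarith)]
      linarith
    · rw [real_inner_smul_left, ← mul_neg, ← mul_add, lt_inv_mul_iff₀ (by linarith)]
      linarith
  -- Otherwise `x ↦ ⟨p₀, x⟩ - (u - s * a)` is negative where `f` is finite and equals `d > 0` at
  -- `x₀`. Adding a large multiple of it to the given minorant keeps a minorant and lifts the value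
  -- at `x₀` above `a`.
  · obtain ⟨p₁, c₁, h₁⟩ := hmin
    set d : ℝ := inner ℝ p₀ x₀ - (u - s * a) with hd
    have hd0 : 0 < d := by linarith
    set k : ℝ := |a - inner ℝ p₁ x₀ - c₁| / d + 1 with hk
    have hk0 : 0 < k := by positivity
    refine ⟨p₁ + k • p₀, c₁ - k * (u - s * a),
      fun x => EReal.coe_le_of_forall_coe fun r hr => ?_, ?_⟩
    -- Raising the height to at least `a` allows `s * max r a` to be replaced by `s * a`, as `s ≥
    -- 0`.
    · have h := hφ' x (max r a) (hr.trans (EReal.coe_le_coe_iff.2 (le_max_left _ _)))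
      have h2 : s * a ≤ s * max r a := mul_le_mul_of_nonneg_left (le_max_right _ _) hs0
      have h3 : inner ℝ p₁ x + c₁ ≤ r := EReal.coe_le_coe_iff.1 ((h₁ x).trans hr)
      have h4 : k * (inner ℝ p₀ x - (u - s * a)) ≤ 0 :=
        mul_nonpos_of_nonneg_of_nonpos hk0.le (by linarith)
      rw [inner_add_left, real_inner_smul_left]
      linarith
    · have h5 : k * d = |a - inner ℝ p₁ x₀ - c₁| + d := by
        rw [hk, add_mul, div_mul_cancel₀ _ hd0.ne', one_mul]
      have h6 := le_abs_self (a - inner ℝ p₁ x₀ - c₁)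
      rw [inner_add_left, real_inner_smul_left]
      have h7 : k * d = k * inner ℝ p₀ x₀ - k * (u - s * a) := by rw [hd]; ring
      linarith

/-- Bounds on conjugates are always handled as affine minorants with real coefficients, so that no
difference of infinities has to be rearranged. -/
theorem legendre_le_coe_iff {n : ℕ} {f : EuclideanSpace ℝ (Fin n) → EReal}
    {p : EuclideanSpace ℝ (Fin n)} {c : ℝ} :
    legendre f p ≤ c ↔ ∀ y, ((inner ℝ p y - c : ℝ) : EReal) ≤ f y := by
  simp only [legendre, iSup_le_iff, EReal.coe_sub_le_coe_iff]

/-- The Fenchel–Moreau theorem. -/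
theorem legendre_legendre {n : ℕ} {f : EuclideanSpace ℝ (Fin n) → EReal}
    (hconv : ∀ x y : EuclideanSpace ℝ (Fin n), ∀ t : ℝ, 0 < t → t < 1 →
      f (t • x + (1 - t) • y) ≤ (t : EReal) * f x + ((1 - t : ℝ) : EReal) * f y)
    (hlsc : LowerSemicontinuous f)
    (hmin : ∃ (p : EuclideanSpace ℝ (Fin n)) (c : ℝ), ∀ x, ((inner ℝ p x + c : ℝ) : EReal) ≤ f x) :
    legendre (legendre f) = f := by
  ext x
  refine le_antisymm ?_ ?_
  · refine le_of_forall_gt_imp_ge_of_dense fun b hb => ?_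
    obtain ⟨r, hr, hrb⟩ := EReal.lt_iff_exists_real_btwn.1 hb
    refine le_trans (legendre_le_coe_iff.2 fun p => ?_) hrb.le
    refine EReal.coe_le_of_forall_coe fun s hs => ?_
    have h := EReal.coe_le_coe_iff.1 ((legendre_le_coe_iff.1 hs x).trans hr.le)
    rw [real_inner_comm]
    linarith
  · refine le_of_forall_lt_imp_le_of_dense fun b hb => ?_
    obtain ⟨a, hba, ha⟩ := EReal.lt_iff_exists_real_btwn.1 hb
    obtain ⟨p, c, hp, hpa⟩ := exists_affine_minorant_gt hconv hlsc hmin ha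
    have h1 : legendre f p ≤ ((-c : ℝ) : EReal) :=
      legendre_le_coe_iff.2 fun y => by simpa [sub_neg_eq_add] using hp y
    calc b ≤ a := hba.le
      _ ≤ ((inner ℝ x p : ℝ) : EReal) - ((-c : ℝ) : EReal) := by
        rw [← EReal.coe_sub, EReal.coe_le_coe_iff, real_inner_comm]; linarith
      _ ≤ ((inner ℝ x p : ℝ) : EReal) - legendre f p := EReal.sub_le_sub le_rfl h1
      _ ≤ _ := le_iSup (fun p => ((inner ℝ x p : ℝ) : EReal) - legendre f p) p

theorem ConvC.legendre_legendre {n : ℕ} (ψ : ConvC n) : legendre (legendre ψ) = ψ := by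
  obtain ⟨m, hm⟩ := ψ.exists_real_le
  exact _root_.legendre_legendre ψ.convex' ψ.lsc' ⟨0, m, by simpa using hm⟩

theorem ConvC.legendre_injective {n : ℕ} {ψ φ : ConvC n} (h : ∀ x, legendre ψ x = legendre φ x) :
    ψ = φ := by
  apply ConvC.ext
  rw [← ψ.legendre_legendre, ← φ.legendre_legendre, funext h]

/-- The conjugate of a proper function is the supremum of countably many affine functions. -/
theorem exists_seq_legendre_eq {n : ℕ} {f : EuclideanSpace ℝ (Fin n) → EReal}
    (hbot : ∀ x, f x ≠ ⊥) (htop : ∃ x, f x < ⊤) :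
    ∃ (y : ℕ → EuclideanSpace ℝ (Fin n)) (r : ℕ → ℝ), (∀ i, f (y i) = r i) ∧
      ∀ p, legendre f p = ⨆ i, ((inner ℝ p (y i) - r i : ℝ) : EReal) := by
  obtain ⟨x₀, hx₀⟩ := htop
  -- Density is taken in the finite part of the graph rather than in the domain: `f` need not be
  -- continuous, and points and values must be approximated together.
  let Γ : Set (EuclideanSpace ℝ (Fin n) × ℝ) := {q | f q.1 = q.2}
  have : Nonempty Γ := ⟨⟨(x₀, (f x₀).toReal), (EReal.coe_toReal hx₀.ne (hbot x₀)).symm⟩⟩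
  let d := TopologicalSpace.denseSeq Γ
  refine ⟨fun i => (d i).1.1, fun i => (d i).1.2, fun i => (d i).2, fun p => le_antisymm ?_ ?_⟩
  · refine iSup_le fun y => ?_
    by_cases hy : f y = ⊤
    · simp [hy]
    set q : Γ := ⟨(y, (f y).toReal), (EReal.coe_toReal hy (hbot y)).symm⟩ with hq
    have hval : ((inner ℝ p y : ℝ) : EReal) - f y = ((inner ℝ p q.1.1 - q.1.2 : ℝ) : EReal) := by
      have h := q.2.symm
      rw [EReal.coe_sub, h]
    rw [hval]
    have hcl : IsClosed {q : Γ | ((inner ℝ p q.1.1 - q.1.2 : ℝ) : EReal)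
        ≤ ⨆ i, ((inner ℝ p (d i).1.1 - (d i).1.2 : ℝ) : EReal)} :=
      isClosed_le (continuous_coe_real_ereal.comp (by fun_prop)) continuous_const
    have hsub : Set.range d ⊆ {q : Γ | ((inner ℝ p q.1.1 - q.1.2 : ℝ) : EReal)
        ≤ ⨆ i, ((inner ℝ p (d i).1.1 - (d i).1.2 : ℝ) : EReal)} := by
      rintro _ ⟨i, rfl⟩
      exact le_iSup (fun i => ((inner ℝ p (d i).1.1 - (d i).1.2 : ℝ) : EReal)) i
    exact hcl.closure_subset_iff.2 hsub (TopologicalSpace.denseRange_denseSeq Γ q)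
  · refine iSup_le fun i => ?_
    have h : f (d i).1.1 = ((d i).1.2 : EReal) := (d i).2
    rw [EReal.coe_sub, ← h]
    exact le_iSup (fun y => ((inner ℝ p y : ℝ) : EReal) - f y) _

/-! ### Law of large numbers and extended-real integrals -/

/-- Simultaneous strong law of large numbers: for countably many integrable functions there is a
sequence of points, lying in a given conull set, along which all empirical averages converge to
the integrals. -/
theorem exists_seq_tendsto_average {Ω ι : Type*} [MeasurableSpace Ω] {μ : Measure Ω}
    [IsProbabilityMeasure μ] [Countable ι] {F : ι → Ω → ℝ} (hm : ∀ i, Measurable (F i))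
    (hF : ∀ i, Integrable (F i) μ) {P : Ω → Prop} (hP : ∀ᵐ ω ∂μ, P ω) :
    ∃ ω : ℕ → Ω, (∀ j, P (ω j)) ∧
      ∀ i, Tendsto (fun N : ℕ => (∑ j ∈ Finset.range N, F i (ω j)) / N) atTop
        (𝓝 (∫ x, F i x ∂μ)) := by
  -- The sample is an i.i.d. sequence with law `μ`; countably many almost sure events hold
  -- simultaneously.
  let ν : Measure (ℕ → Ω) := Measure.infinitePi fun _ : ℕ => μ
  have hmp : ∀ j, MeasurePreserving (fun ω : ℕ → Ω => ω j) ν μ := fun j =>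
    measurePreserving_eval_infinitePi (fun _ : ℕ => μ) j
  have h1 : ∀ᵐ ω ∂ν, ∀ j, P (ω j) :=
    ae_all_iff.2 fun j => (hmp j).quasiMeasurePreserving.ae hP
  have h2 : ∀ᵐ ω ∂ν, ∀ i, Tendsto (fun N : ℕ => (∑ j ∈ Finset.range N, F i (ω j)) / N) atTop
      (𝓝 (∫ x, F i x ∂μ)) := by
    refine ae_all_iff.2 fun i => ?_
    have hind := ProbabilityTheory.iIndepFun_infinitePi (P := fun _ : ℕ => μ)
      (X := fun _ => F i) (fun _ => hm i)
    have := ProbabilityTheory.strong_law_ae_real (μ := ν) (fun j ω => F i (ω j))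
      ((hmp 0).integrable_comp_of_integrable (hF i)) (fun j k hjk => hind.indepFun hjk)
      (fun j => ⟨((hm i).comp (measurable_pi_apply j)).aemeasurable,
        ((hm i).comp (measurable_pi_apply 0)).aemeasurable, by
          change ν.map (F i ∘ fun ω => ω j) = ν.map (F i ∘ fun ω => ω 0)
          rw [← Measure.map_map (hm i) (measurable_pi_apply j),
            ← Measure.map_map (hm i) (measurable_pi_apply 0), (hmp j).map_eq, (hmp 0).map_eq]⟩)
    have he : ∫ ω, F i (ω 0) ∂ν = ∫ x, F i x ∂μ := by
      rw [← (hmp 0).map_eq,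
        integral_map (measurable_pi_apply 0).aemeasurable (hm i).aestronglyMeasurable]
    rw [← he]
    exact this
  obtain ⟨ω, hω1, hω2⟩ := (h1.and h2).exists
  exact ⟨ω, hω1, hω2⟩

/-- Monotone convergence for the integral of extended-real-valued functions. -/
theorem erealIntegral_iSup {Ω : Type*} [MeasurableSpace Ω] {μ : Measure Ω} {F : ℕ → Ω → ℝ}
    (hmono : ∀ ω, Monotone fun k => F k ω) (hm : ∀ k, Measurable (F k))
    (hF : ∀ k, Integrable (F k) μ) :
    erealIntegral μ (fun ω => ⨆ k, (F k ω : EReal)) = ⨆ k, ((∫ ω, F k ω ∂μ : ℝ) : EReal) := by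
  have hmonoI : Monotone fun k => ((∫ ω, F k ω ∂μ : ℝ) : EReal) := fun k l hkl =>
    EReal.coe_le_coe_iff.2 (integral_mono (hF k) (hF l) fun ω => hmono ω hkl)
  refine tendsto_nhds_unique ?_ (tendsto_atTop_iSup hmonoI)
  have hlim : ∀ ω, Tendsto (fun k => (F k ω : EReal)) atTop (𝓝 (⨆ k, (F k ω : EReal))) :=
    fun ω => tendsto_atTop_iSup fun k l hkl => EReal.coe_le_coe_iff.2 (hmono ω hkl)
  have hpos : Tendsto (fun k => ∫⁻ ω, ENNReal.ofReal (F k ω) ∂μ) atTop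
      (𝓝 (∫⁻ ω, (⨆ k, (F k ω : EReal)).toENNReal ∂μ)) := by
    refine lintegral_tendsto_of_tendsto_of_monotone
      (fun k => (hm k).ennreal_ofReal.aemeasurable)
      (Eventually.of_forall fun ω k l hkl => ENNReal.ofReal_le_ofReal (hmono ω hkl))
      (Eventually.of_forall fun ω => ?_)
    exact (EReal.continuous_toENNReal.tendsto _).comp (hlim ω)
  have hfin : ∀ k, ∫⁻ ω, ENNReal.ofReal (-F k ω) ∂μ ≠ ⊤ := fun k => (hF k).neg.lintegral_lt_top.ne
  have hfin' : ∀ k, ∫⁻ ω, ENNReal.ofReal (F k ω) ∂μ ≠ ⊤ := fun k => (hF k).lintegral_lt_top.ne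
  have hneg : Tendsto (fun k => ∫⁻ ω, ENNReal.ofReal (-F k ω) ∂μ) atTop
      (𝓝 (∫⁻ ω, (-⨆ k, (F k ω : EReal)).toENNReal ∂μ)) := by
    -- The negative parts decrease, so that of `F 0` dominates.
    refine tendsto_lintegral_of_dominated_convergence (fun ω => ENNReal.ofReal (-F 0 ω))
      (fun k => (hm k).neg.ennreal_ofReal)
      (fun k => Eventually.of_forall fun ω =>
        ENNReal.ofReal_le_ofReal (neg_le_neg (hmono ω (Nat.zero_le k)))) (hfin 0)
      (Eventually.of_forall fun ω => ?_)
    have := (EReal.continuous_toENNReal.tendsto _).comp ((continuous_neg.tendsto _).comp (hlim ω))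
    refine this.congr fun k => ?_
    simp [-EReal.coe_neg, ← EReal.coe_neg]
  have hle : ∫⁻ ω, (-⨆ k, (F k ω : EReal)).toENNReal ∂μ ≠ ⊤ := by
    refine ne_top_of_le_ne_top (hfin 0) (lintegral_mono fun ω => ?_)
    have : -(⨆ k, (F k ω : EReal)) ≤ ((-F 0 ω : ℝ) : EReal) := by
      rw [EReal.coe_neg]
      exact EReal.neg_le_neg_iff.2 (le_iSup (fun k => (F k ω : EReal)) 0)
    simpa [← EReal.coe_neg, -EReal.coe_neg] using EReal.toENNReal_le_toENNReal this
  have hE : ∀ k, ((∫ ω, F k ω ∂μ : ℝ) : EReal)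
      = ((∫⁻ ω, ENNReal.ofReal (F k ω) ∂μ : ENNReal) : EReal)
        - ((∫⁻ ω, ENNReal.ofReal (-F k ω) ∂μ : ENNReal) : EReal) := fun k => by
    rw [integral_eq_lintegral_pos_part_sub_lintegral_neg_part (hF k), EReal.coe_sub,
      EReal.coe_ennreal_toReal (hfin' k), EReal.coe_ennreal_toReal (hfin k)]
  simp only [hE]
  have hp' := (continuous_coe_ennreal_ereal.tendsto _).comp hpos
  have hn' := (continuous_neg.tendsto _).comp ((continuous_coe_ennreal_ereal.tendsto _).comp hneg)
  simp only [erealIntegral, sub_eq_add_neg]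
  -- The limit of the negative parts is finite, so the difference is not of the form `⊤ - ⊤`.
  refine (EReal.continuousAt_add (Or.inr ?_) (Or.inr ?_)).tendsto.comp (hp'.prodMk_nhds hn')
  · simpa using hle
  · simp

/-- A function whose extended-real-valued integral is a real number is almost everywhere finite
and integrable. -/
theorem integrable_toReal_of_erealIntegral_eq_coe {Ω : Type*} [MeasurableSpace Ω] {μ : Measure Ω}
    {f : Ω → EReal} (hm : Measurable f) (hbot : ∀ ω, f ω ≠ ⊥) {r : ℝ}
    (h : erealIntegral μ f = r) :
    (∀ᵐ ω ∂μ, f ω ≠ ⊤) ∧ Integrable (fun ω => (f ω).toReal) μ ∧ ∫ ω, (f ω).toReal ∂μ = r := by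
  unfold erealIntegral at h
  -- With an infinite positive part the difference is `⊤`, or `⊥` by the convention for `⊤ - ⊤`; it
  -- is never real.
  have hp : ∫⁻ ω, (f ω).toENNReal ∂μ ≠ ⊤ := by
    intro ht
    rw [ht] at h
    by_cases h' : ∫⁻ ω, (-f ω).toENNReal ∂μ = ⊤
    · simp [h'] at h
    · rw [← EReal.coe_ennreal_toReal h', EReal.coe_ennreal_top, EReal.top_sub_coe] at h
      exact absurd h (by simp)
  have hn : ∫⁻ ω, (-f ω).toENNReal ∂μ ≠ ⊤ := by
    intro ht
    rw [ht] at h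
    simp [sub_eq_add_neg] at h
  have hmp : Measurable fun ω => (f ω).toENNReal := hm.ereal_toENNReal
  have hmn : Measurable fun ω => (-f ω).toENNReal := hm.neg.ereal_toENNReal
  have hae : ∀ᵐ ω ∂μ, f ω ≠ ⊤ := by
    filter_upwards [ae_lt_top hmp hp] with ω hω h
    simp [h] at hω
  have e1 : ∀ᵐ ω ∂μ, ENNReal.ofReal (f ω).toReal = (f ω).toENNReal := by
    filter_upwards [hae] with ω hω
    rw [EReal.toENNReal_of_ne_top hω]
  have e2 : ∀ᵐ ω ∂μ, ENNReal.ofReal (-(f ω).toReal) = (-f ω).toENNReal := by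
    filter_upwards [hae] with ω hω
    rw [EReal.toENNReal_of_ne_top (by simpa using hbot ω), EReal.toReal_neg_eq]
  have hint : Integrable (fun ω => (f ω).toReal) μ := by
    refine ⟨hm.ereal_toReal.aestronglyMeasurable, ?_⟩
    have : ∫⁻ ω, ‖(f ω).toReal‖ₑ ∂μ
        ≤ ∫⁻ ω, ((f ω).toENNReal + (-f ω).toENNReal) ∂μ := by
      refine lintegral_mono_ae ?_
      filter_upwards [e1, e2] with ω h1 h2
      rw [← h1, ← h2, Real.enorm_eq_ofReal_abs]
      rcases abs_cases (f ω).toReal with ⟨h, -⟩ | ⟨h, -⟩ <;> rw [h] <;> simp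
    refine this.trans_lt ?_
    rw [lintegral_add_left hmp]
    exact ENNReal.add_lt_top.2 ⟨hp.lt_top, hn.lt_top⟩
  refine ⟨hae, hint, ?_⟩
  rw [integral_eq_lintegral_pos_part_sub_lintegral_neg_part hint, lintegral_congr_ae e1,
    lintegral_congr_ae e2, ← EReal.coe_eq_coe_iff, ← h, EReal.coe_sub,
    EReal.coe_ennreal_toReal hp, EReal.coe_ennreal_toReal hn]

/-! ### Rotations as isometries -/

namespace SO

variable {n : ℕ}

theorem act_inv_act (ϑ : SO n) (x : EuclideanSpace ℝ (Fin n)) : act ϑ⁻¹ (act ϑ x) = x :=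
  (act ϑ).left_inv x

/-- The inverse of an orthogonal matrix is its transpose. Hence rotating a function rotates its
conjugate and the slopes of its affine minorants. -/
theorem inner_act_inv (ϑ : SO n) (x y : EuclideanSpace ℝ (Fin n)) :
    inner ℝ (act ϑ⁻¹ x) y = inner ℝ x (act ϑ y) := by
  rw [EuclideanSpace.inner_eq_star_dotProduct, EuclideanSpace.inner_eq_star_dotProduct, act_apply,
    act_apply, coe_inv]
  simp only [star_trivial]
  rw [Matrix.mulVec_transpose, dotProduct_comm, ← Matrix.dotProduct_mulVec, dotProduct_comm]

theorem norm_act (ϑ : SO n) (x : EuclideanSpace ℝ (Fin n)) : ‖act ϑ x‖ = ‖x‖ := by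
  have h : ‖act ϑ x‖ ^ 2 = ‖x‖ ^ 2 := by
    rw [← real_inner_self_eq_norm_sq, ← real_inner_self_eq_norm_sq, ← inner_act_inv, act_inv_act]
  exact (sq_eq_sq₀ (norm_nonneg _) (norm_nonneg _)).1 h

theorem continuous_act (x : EuclideanSpace ℝ (Fin n)) : Continuous fun ϑ : SO n => act ϑ x := by
  simp only [act_apply]
  exact (PiLp.continuous_toLp 2 _).comp
    (Continuous.matrix_mulVec continuous_subtype_val continuous_const)

theorem integrable_of_continuous {F : Type*} [NormedAddCommGroup F] {f : SO n → F}
    (hf : Continuous f) : Integrable f (haar n) :=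
  hf.integrable_of_hasCompactSupport (HasCompactSupport.of_compactSpace f)

end SO

/-! ### Finite maxima of affine functions and their rotational averages -/

/-- The maximum of the first `k + 1` of the affine functions `p ↦ ⟨p, y i⟩ - r i`. -/
noncomputable def maxAffine {n : ℕ} (y : ℕ → EuclideanSpace ℝ (Fin n)) (r : ℕ → ℝ) (k : ℕ)
    (p : EuclideanSpace ℝ (Fin n)) : ℝ :=
  (Finset.range (k + 1)).sup' Finset.nonempty_range_add_one fun i => inner ℝ p (y i) - r i

section maxAffine

variable {n : ℕ} {y : ℕ → EuclideanSpace ℝ (Fin n)} {r : ℕ → ℝ}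

/-- Attainment reduces convexity, monotonicity and the Lipschitz bound to a single affine function.
-/
theorem exists_maxAffine_eq (k : ℕ) (p : EuclideanSpace ℝ (Fin n)) :
    ∃ i ≤ k, maxAffine y r k p = inner ℝ p (y i) - r i := by
  obtain ⟨i, hi, h⟩ := Finset.exists_mem_eq_sup' (s := Finset.range (k + 1))
    Finset.nonempty_range_add_one fun i => inner ℝ p (y i) - r i
  exact ⟨i, Nat.lt_succ_iff.1 (Finset.mem_range.1 hi), h⟩

theorem le_maxAffine {k i : ℕ} (hi : i ≤ k) (p : EuclideanSpace ℝ (Fin n)) :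
    inner ℝ p (y i) - r i ≤ maxAffine y r k p :=
  Finset.le_sup' (fun i => inner ℝ p (y i) - r i) (Finset.mem_range.2 (Nat.lt_succ_iff.2 hi))

theorem maxAffine_mono (p : EuclideanSpace ℝ (Fin n)) : Monotone fun k => maxAffine y r k p := by
  intro k l hkl
  obtain ⟨i, hi, h⟩ := exists_maxAffine_eq (y := y) (r := r) k p
  exact h.trans_le (le_maxAffine (hi.trans hkl) p)

theorem iSup_maxAffine (p : EuclideanSpace ℝ (Fin n)) :
    ⨆ k, (maxAffine y r k p : EReal) = ⨆ i, ((inner ℝ p (y i) - r i : ℝ) : EReal) := by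
  refine le_antisymm (iSup_le fun k => ?_) (iSup_mono fun i => ?_)
  · obtain ⟨i, -, h⟩ := exists_maxAffine_eq (y := y) (r := r) k p
    rw [h]
    exact le_iSup (fun i => ((inner ℝ p (y i) - r i : ℝ) : EReal)) i
  · exact EReal.coe_le_coe_iff.2 (le_maxAffine le_rfl p)

theorem maxAffine_convex (k : ℕ) (p q : EuclideanSpace ℝ (Fin n)) {t : ℝ} (h0 : 0 ≤ t)
    (h1 : t ≤ 1) : maxAffine y r k (t • p + (1 - t) • q)
      ≤ t * maxAffine y r k p + (1 - t) * maxAffine y r k q := by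
  obtain ⟨i, hi, h⟩ := exists_maxAffine_eq (y := y) (r := r) k (t • p + (1 - t) • q)
  rw [h, inner_add_left, real_inner_smul_left, real_inner_smul_left]
  have hp := mul_le_mul_of_nonneg_left (le_maxAffine (y := y) (r := r) hi p) h0
  have hq := mul_le_mul_of_nonneg_left (le_maxAffine (y := y) (r := r) hi q) (sub_nonneg.2 h1)
  linarith

theorem exists_maxAffine_lipschitz (y : ℕ → EuclideanSpace ℝ (Fin n)) (r : ℕ → ℝ) (k : ℕ) :
    ∃ M, 0 < M ∧ ∀ p q, maxAffine y r k p ≤ maxAffine y r k q + M * ‖p - q‖ := by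
  -- The sum dominates every slope involved; the extra `1` makes the constant positive.
  refine ⟨∑ i ∈ Finset.range (k + 1), ‖y i‖ + 1, by positivity, fun p q => ?_⟩
  obtain ⟨i, hi, h⟩ := exists_maxAffine_eq (y := y) (r := r) k p
  have h1 : inner ℝ p (y i) = inner ℝ q (y i) + inner ℝ (p - q) (y i) := by
    rw [← inner_add_left]; simp
  have h2 := real_inner_le_norm (p - q) (y i)
  have h3 : ‖y i‖ ≤ ∑ i ∈ Finset.range (k + 1), ‖y i‖ :=
    Finset.single_le_sum (f := fun i => ‖y i‖) (fun _ _ => norm_nonneg _)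
      (Finset.mem_range.2 (Nat.lt_succ_iff.2 hi))
  have h4 := le_maxAffine (y := y) (r := r) hi q
  have h5 := mul_le_mul_of_nonneg_right h3 (norm_nonneg (p - q))
  have h6 := norm_nonneg (p - q)
  rw [h, h1]
  linarith

theorem continuous_maxAffine (k : ℕ) : Continuous (maxAffine y r k) := by
  have : maxAffine y r k = (Finset.range (k + 1)).sup' Finset.nonempty_range_add_one
      fun i p => inner ℝ p (y i) - r i := by
    ext p; simp [maxAffine, Finset.sup'_apply]
  rw [this]
  exact Continuous.finset_sup' _ fun i _ => by fun_prop

theorem continuous_maxAffine_act (k : ℕ) (p : EuclideanSpace ℝ (Fin n)) :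
    Continuous fun ϑ : SO n => maxAffine y r k (SO.act ϑ⁻¹ p) :=
  (continuous_maxAffine k).comp ((SO.continuous_act p).comp continuous_inv)

/-- The rotational average of `maxAffine`. -/
noncomputable def rotMaxAffine (y : ℕ → EuclideanSpace ℝ (Fin n)) (r : ℕ → ℝ) (k : ℕ)
    (p : EuclideanSpace ℝ (Fin n)) : ℝ :=
  ∫ ϑ, maxAffine y r k (SO.act ϑ⁻¹ p) ∂(SO.haar n)

theorem rotMaxAffine_convex (k : ℕ) (p q : EuclideanSpace ℝ (Fin n)) {t : ℝ} (h0 : 0 ≤ t)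
    (h1 : t ≤ 1) : rotMaxAffine y r k (t • p + (1 - t) • q)
      ≤ t * rotMaxAffine y r k p + (1 - t) * rotMaxAffine y r k q := by
  have hp := SO.integrable_of_continuous (continuous_maxAffine_act (y := y) (r := r) k p)
  have hq := SO.integrable_of_continuous (continuous_maxAffine_act (y := y) (r := r) k q)
  unfold rotMaxAffine
  rw [← integral_const_mul, ← integral_const_mul,
    ← integral_add (hp.const_mul _) (hq.const_mul _)]
  refine integral_mono (SO.integrable_of_continuous (continuous_maxAffine_act k _))
    ((hp.const_mul _).add (hq.const_mul _)) fun ϑ => ?_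
  simpa only [map_add, map_smul] using maxAffine_convex k _ _ h0 h1

/-- Rotations preserve `‖p - q‖`, so averaging does not change the Lipschitz constant. -/
theorem rotMaxAffine_le_add {k : ℕ} {M : ℝ}
    (hM : ∀ p q, maxAffine y r k p ≤ maxAffine y r k q + M * ‖p - q‖)
    (p q : EuclideanSpace ℝ (Fin n)) :
    rotMaxAffine y r k p ≤ rotMaxAffine y r k q + M * ‖p - q‖ := by
  have hq := SO.integrable_of_continuous (continuous_maxAffine_act (y := y) (r := r) k q)
  have : rotMaxAffine y r k q + M * ‖p - q‖
      = ∫ ϑ, (maxAffine y r k (SO.act ϑ⁻¹ q) + M * ‖p - q‖) ∂(SO.haar n) := by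
    rw [integral_add hq (integrable_const _)]
    simp [rotMaxAffine]
  rw [this]
  refine integral_mono (SO.integrable_of_continuous (continuous_maxAffine_act k _))
    (hq.add (integrable_const _)) fun ϑ => ?_
  have := hM (SO.act ϑ⁻¹ p) (SO.act ϑ⁻¹ q)
  rwa [← map_sub, SO.norm_act] at this

theorem continuous_rotMaxAffine (k : ℕ) : Continuous (rotMaxAffine y r k) := by
  obtain ⟨M, hM0, hM⟩ := exists_maxAffine_lipschitz y r k
  refine (LipschitzWith.of_le_add_mul ⟨M, hM0.le⟩ fun p q => ?_).continuous
  rw [dist_eq_norm]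
  exact rotMaxAffine_le_add hM p q

theorem rotMaxAffine_le {k : ℕ} {p : EuclideanSpace ℝ (Fin n)} {c : ℝ}
    (h : ∀ ϑ : SO n, maxAffine y r k (SO.act ϑ⁻¹ p) ≤ c) : rotMaxAffine y r k p ≤ c := by
  have := integral_mono (SO.integrable_of_continuous (continuous_maxAffine_act (y := y) (r := r) k p))
    (integrable_const c) h
  simpa [rotMaxAffine] using this

/-- For `k = 0` the maximum is one affine function, and its average is affine with slope the mean of
the rotated `y 0`. This provides the affine minorant of the averaged conjugate. -/
theorem exists_rotMaxAffine_zero_eq (y : ℕ → EuclideanSpace ℝ (Fin n)) (r : ℕ → ℝ) :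
    ∃ w, ∀ p, rotMaxAffine y r 0 p = inner ℝ w p - r 0 := by
  refine ⟨∫ ϑ, SO.act ϑ (y 0) ∂(SO.haar n), fun p => ?_⟩
  have hi := SO.integrable_of_continuous (SO.continuous_act (y 0))
  have h := ContinuousLinearMap.integral_comp_comm (innerSL ℝ p) hi
  rw [real_inner_comm]
  simp only [innerSL_apply_apply] at h
  have h2 : ∀ ϑ : SO n, maxAffine y r 0 (SO.act ϑ⁻¹ p) = inner ℝ p (SO.act ϑ (y 0)) - r 0 := by
    intro ϑ
    simp [maxAffine, SO.inner_act_inv]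
  simp only [rotMaxAffine, h2]
  rw [integral_sub (hi.const_inner p) (integrable_const _), h]
  simp

/-- Monotone convergence along the truncations. The right-hand side shows that the average is convex
and lower semicontinuous even where it is infinite. -/
theorem erealIntegral_legendre_act {ψ : EuclideanSpace ℝ (Fin n) → EReal}
    (h : ∀ p, legendre ψ p = ⨆ i, ((inner ℝ p (y i) - r i : ℝ) : EReal))
    (p : EuclideanSpace ℝ (Fin n)) :
    erealIntegral (SO.haar n) (fun ϑ => legendre ψ (SO.act ϑ⁻¹ p))
      = ⨆ k, (rotMaxAffine y r k p : EReal) := by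
  simp only [h, ← iSup_maxAffine]
  exact erealIntegral_iSup (fun ϑ => maxAffine_mono _)
    (fun k => (continuous_maxAffine_act k p).measurable)
    fun k => SO.integrable_of_continuous (continuous_maxAffine_act k p)

end maxAffine

/-! ### Existence and uniqueness of the symmetrization -/

/-- Coercive convex functions grow at least linearly. -/
theorem ConvC.exists_linear_growth {n : ℕ} (ψ : ConvC n) :
    ∃ δ : ℝ, 0 < δ ∧ ∃ M : ℝ, ∀ y, ((δ * ‖y‖ - M : ℝ) : EReal) ≤ ψ y := by
  obtain ⟨m, hm⟩ := ψ.exists_real_le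
  obtain ⟨x₀, hx₀⟩ := ψ.proper'
  set a := (ψ x₀).toReal with ha
  have hxa : ψ x₀ = a := (EReal.coe_toReal hx₀.ne (ψ.ne_bot' x₀)).symm
  have hma : m ≤ a := EReal.coe_le_coe_iff.1 (hxa ▸ hm x₀)
  have hb := Bornology.isBounded_compl_iff.2
    (ψ.coercive'.eventually (lt_mem_nhds (EReal.coe_lt_top (a + 1))))
  obtain ⟨R, hR0, hR⟩ := hb.subset_ball_lt 0 x₀
  have hout : ∀ z, R ≤ dist z x₀ → ((a + 1 : ℝ) : EReal) < ψ z := by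
    intro z hz
    by_contra hcon
    exact absurd (Metric.mem_ball.1 (hR hcon)) (not_lt.2 hz)
  have key : ∀ y, ((R⁻¹ * ‖y - x₀‖ - 1 + m : ℝ) : EReal) ≤ ψ y := by
    intro y
    rcases le_or_gt ‖y - x₀‖ R with h | h
    · refine le_trans (EReal.coe_le_coe_iff.2 ?_) (hm y)
      have : R⁻¹ * ‖y - x₀‖ ≤ 1 := by rwa [inv_mul_le_iff₀ hR0, mul_one]
      linarith
    · refine EReal.coe_le_of_forall_coe fun s hs => ?_
      have hy0 : 0 < ‖y - x₀‖ := hR0.trans h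
      -- This is the point of the segment from `x₀` to `y` at distance `R` from `x₀`. There `ψ`
      -- exceeds `ψ x₀ + 1`, so convexity forces average slope at least `R⁻¹` from `x₀` to `y`.
      set t := R / ‖y - x₀‖ with ht
      have ht0 : 0 < t := by positivity
      have ht1 : t < 1 := (div_lt_one hy0).2 h
      have hc := ψ.convex' y x₀ t ht0 ht1
      have hd : R ≤ dist (t • y + (1 - t) • x₀) x₀ := by
        have : t • y + (1 - t) • x₀ - x₀ = t • (y - x₀) := by module
        rw [dist_eq_norm, this, norm_smul, Real.norm_of_nonneg ht0.le, ht,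
          div_mul_cancel₀ _ hy0.ne']
      have h2 : ((a + 1 : ℝ) : EReal) < ((t * s + (1 - t) * a : ℝ) : EReal) := by
        refine (hout _ hd).trans_le (hc.trans ?_)
        rw [hxa, EReal.coe_add, EReal.coe_mul, EReal.coe_mul]
        gcongr
      have h3 := EReal.coe_lt_coe_iff.1 h2
      have h4 : R⁻¹ * ‖y - x₀‖ * t = 1 := by rw [ht]; field_simp
      have h5 : 1 < t * (s - a) := by linarith
      have h6 : R⁻¹ * ‖y - x₀‖ < s - a := by
        by_contra hcon
        have := mul_le_mul_of_nonneg_left (not_lt.1 hcon) ht0.le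
        linarith
      linarith
  refine ⟨R⁻¹, inv_pos.2 hR0, R⁻¹ * ‖x₀‖ + 1 - m, fun y => le_trans ?_ (key y)⟩
  refine EReal.coe_le_coe_iff.2 ?_
  have h1 : ‖y‖ - ‖x₀‖ ≤ ‖y - x₀‖ := norm_sub_norm_le y x₀
  have h2 := mul_le_mul_of_nonneg_left h1 (inv_pos.2 hR0).le
  linarith

/-- The conjugate of a function that has an affine minorant and is bounded above near the origin,
as an element of `ConvC n`. -/
noncomputable def ConvC.conjugate {n : ℕ} (g : EuclideanSpace ℝ (Fin n) → EReal)
    (hmin : ∃ (p : EuclideanSpace ℝ (Fin n)) (c : ℝ), ∀ x, ((inner ℝ p x + c : ℝ) : EReal) ≤ g x)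
    (hbdd : ∃ δ : ℝ, 0 < δ ∧ ∃ M : ℝ, ∀ p, ‖p‖ ≤ δ → g p ≤ M) : ConvC n where
  toFun := legendre g
  ne_bot' x := by
    obtain ⟨δ, hδ, M, hM⟩ := hbdd
    intro h
    have := legendre_le_coe_iff.1 (h.le.trans (bot_le (a := ((-M - 1 : ℝ) : EReal)))) 0
    have h2 := EReal.coe_le_coe_iff.1 (this.trans (hM 0 (by simpa using hδ.le)))
    simp at h2
    linarith
  convex' x y t h0 h1 := by
    obtain ⟨q, c, hq⟩ := hmin
    refine iSup_le fun p => ?_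
    by_cases htop : g p = ⊤
    · simp [htop]
    have hbot : g p ≠ ⊥ := ne_bot_of_le_ne_bot (EReal.coe_ne_bot _) (hq p)
    rw [← EReal.coe_toReal htop hbot]
    set s := (g p).toReal with hs
    have hle : ∀ z, ((inner ℝ z p - s : ℝ) : EReal) ≤ legendre g z := fun z => by
      rw [EReal.coe_sub, hs, EReal.coe_toReal htop hbot]
      exact le_iSup (fun p => ((inner ℝ z p : ℝ) : EReal) - g p) p
    calc ((inner ℝ (t • x + (1 - t) • y) p : ℝ) : EReal) - (s : EReal)
        = ((t : ℝ) : EReal) * ((inner ℝ x p - s : ℝ) : EReal)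
          + ((1 - t : ℝ) : EReal) * ((inner ℝ y p - s : ℝ) : EReal) := by
          rw [← EReal.coe_mul, ← EReal.coe_mul, ← EReal.coe_add, ← EReal.coe_sub,
            inner_add_left, real_inner_smul_left, real_inner_smul_left]
          congr 1
          ring
      _ ≤ _ := add_le_add (mul_le_mul_of_nonneg_left (hle x) (EReal.coe_nonneg.2 h0.le))
          (mul_le_mul_of_nonneg_left (hle y) (EReal.coe_nonneg.2 (by linarith)))
  coercive' := by
    obtain ⟨δ, hδ, M, hM⟩ := hbdd
    rw [EReal.tendsto_nhds_top_iff_real]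
    intro a
    have h := (tendsto_norm_cobounded_atTop (E := EuclideanSpace ℝ (Fin n))).eventually
      (eventually_gt_atTop (max 0 ((a + M) / δ)))
    filter_upwards [h] with x hx
    have hx0 : 0 < ‖x‖ := (le_max_left _ _).trans_lt hx
    have hxa : a + M < δ * ‖x‖ := by
      rw [← div_lt_iff₀' hδ]; exact (le_max_right _ _).trans_lt hx
    by_contra hcon
    -- Testing at the point of norm `δ` in the direction of `x`, where `g ≤ M`, bounds the conjugate
    -- below by `δ * ‖x‖ - M`.
    have h1 := legendre_le_coe_iff.1 (not_lt.1 hcon) ((δ / ‖x‖) • x)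
    have h2 := EReal.coe_le_coe_iff.1 (h1.trans (hM _ (by
      rw [norm_smul, Real.norm_of_nonneg (by positivity), div_mul_cancel₀ _ hx0.ne'])))
    rw [real_inner_smul_right, real_inner_self_eq_norm_sq] at h2
    have : δ / ‖x‖ * ‖x‖ ^ 2 = δ * ‖x‖ := by field_simp
    linarith
  proper' := by
    obtain ⟨q, c, hq⟩ := hmin
    refine ⟨q, lt_of_le_of_lt ?_ (EReal.coe_lt_top (-c))⟩
    exact legendre_le_coe_iff.2 fun y => by simpa using hq y
  lsc' := by
    refine lowerSemicontinuous_iSup fun p => ?_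
    obtain ⟨q, c, hq⟩ := hmin
    by_cases htop : g p = ⊤
    · simp only [htop, EReal.sub_top]
      exact lowerSemicontinuous_const
    have hbot : g p ≠ ⊥ := ne_bot_of_le_ne_bot (EReal.coe_ne_bot _) (hq p)
    have : (fun x => ((inner ℝ x p : ℝ) : EReal) - g p)
        = fun x => ((inner ℝ x p - (g p).toReal : ℝ) : EReal) := by
      ext x
      rw [EReal.coe_sub, EReal.coe_toReal htop hbot]
    rw [this]
    exact (continuous_coe_real_ereal.comp (by fun_prop)).lowerSemicontinuous

/-- Existence and uniqueness of the rotational epi-symmetrization. -/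
theorem existsUnique_isRotEpiSymmetrization {n : ℕ} (ψ : ConvC n) :
    ∃! φ : ConvC n, IsRotEpiSymmetrization ψ φ := by
  obtain ⟨y, r, hyr, hL⟩ := exists_seq_legendre_eq ψ.ne_bot' ψ.proper'
  set g : EuclideanSpace ℝ (Fin n) → EReal := fun p => ⨆ k, (rotMaxAffine y r k p : EReal) with hg
  have hle : ∀ k p, (rotMaxAffine y r k p : EReal) ≤ g p := fun k p =>
    le_iSup (fun k => (rotMaxAffine y r k p : EReal)) k
  have hconv : ∀ x y : EuclideanSpace ℝ (Fin n), ∀ t : ℝ, 0 < t → t < 1 →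
      g (t • x + (1 - t) • y) ≤ (t : EReal) * g x + ((1 - t : ℝ) : EReal) * g y := by
    intro p q t h0 h1
    refine iSup_le fun k => ?_
    refine (EReal.coe_le_coe_iff.2 (rotMaxAffine_convex k p q h0.le h1.le)).trans ?_
    rw [EReal.coe_add, EReal.coe_mul, EReal.coe_mul]
    exact add_le_add (mul_le_mul_of_nonneg_left (hle k p) (EReal.coe_nonneg.2 h0.le))
      (mul_le_mul_of_nonneg_left (hle k q) (EReal.coe_nonneg.2 (by linarith)))
  have hlsc : LowerSemicontinuous g := lowerSemicontinuous_iSup fun k =>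
    (continuous_coe_real_ereal.comp (continuous_rotMaxAffine k)).lowerSemicontinuous
  have hmin : ∃ (p : EuclideanSpace ℝ (Fin n)) (c : ℝ),
      ∀ x, ((inner ℝ p x + c : ℝ) : EReal) ≤ g x := by
    obtain ⟨w, hw⟩ := exists_rotMaxAffine_zero_eq y r
    refine ⟨w, -r 0, fun x => le_trans (le_of_eq ?_) (hle 0 x)⟩
    rw [hw, sub_eq_add_neg]
  have hbdd : ∃ δ : ℝ, 0 < δ ∧ ∃ M : ℝ, ∀ p, ‖p‖ ≤ δ → g p ≤ M := by
    obtain ⟨δ, hδ, M, hM⟩ := ψ.exists_linear_growth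
    refine ⟨δ, hδ, M, fun p hp => iSup_le fun k => EReal.coe_le_coe_iff.2
      (rotMaxAffine_le fun ϑ => ?_)⟩
    -- For `‖p‖ ≤ δ` the linear growth of `ψ` absorbs `⟨p, y⟩`, so every affine piece is at most
    -- `M`.
    obtain ⟨i, -, h⟩ := exists_maxAffine_eq (y := y) (r := r) k (SO.act ϑ⁻¹ p)
    have h1 := EReal.coe_le_coe_iff.1 (hyr i ▸ hM (y i))
    have h2 := real_inner_le_norm (SO.act ϑ⁻¹ p) (y i)
    rw [SO.norm_act] at h2
    have h3 := mul_le_mul_of_nonneg_right hp (norm_nonneg (y i))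
    linarith
  refine ⟨ConvC.conjugate g hmin hbdd, fun x => ?_, fun φ hφ => ConvC.legendre_injective fun x => ?_⟩
  · rw [erealIntegral_legendre_act hL]
    exact congrFun (legendre_legendre hconv hlsc hmin) x
  · rw [hφ x, erealIntegral_legendre_act hL]
    exact (congrFun (legendre_legendre hconv hlsc hmin) x).symm

/-! ### Epi-averages and their conjugates -/

theorem SO.act_act_inv {n : ℕ} (ϑ : SO n) (x : EuclideanSpace ℝ (Fin n)) :
    SO.act ϑ (SO.act ϑ⁻¹ x) = x :=
  (SO.act ϑ).right_inv x

/-- Infinite `c` is included, so infinite values of `Ψ` need no separate treatment. -/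
theorem EReal.coe_mul_add_coe_one_sub_mul {t : ℝ} (h0 : 0 < t) (h1 : t < 1) (c : EReal) :
    (t : EReal) * c + ((1 - t : ℝ) : EReal) * c = c := by
  induction c with
  | bot => simp [EReal.coe_mul_bot_of_pos h0]
  | coe c =>
    rw [← EReal.coe_mul, ← EReal.coe_mul, ← EReal.coe_add]
    congr 1
    ring
  | top => rw [EReal.coe_mul_top_of_pos h0, EReal.coe_mul_top_of_pos (by linarith)]; rfl

namespace ConvC

variable {n : ℕ}

/-- The epi-convex combination `t ⬝ ψ₁ □ (1 - t) ⬝ ψ₂`. -/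
noncomputable def epiComb (ψ₁ ψ₂ : ConvC n) (t : ℝ) (h0 : 0 < t) (h1 : t < 1) : ConvC n :=
  (ψ₁.epiMul t h0).epiSum (ψ₂.epiMul (1 - t) (sub_pos.2 h1))

/-- One half of the rule that conjugation turns epi-combinations into convex combinations: upper
bounds for the conjugates at `q` combine linearly. -/
theorem inner_sub_le_epiComb {ψ₁ ψ₂ : ConvC n} {t : ℝ} {h0 : 0 < t} {h1 : t < 1}
    {q : EuclideanSpace ℝ (Fin n)} {c₁ c₂ : ℝ}
    (hψ₁ : ∀ z, ((inner ℝ q z - c₁ : ℝ) : EReal) ≤ ψ₁ z)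
    (hψ₂ : ∀ z, ((inner ℝ q z - c₂ : ℝ) : EReal) ≤ ψ₂ z) (z : EuclideanSpace ℝ (Fin n)) :
    ((inner ℝ q z - (t * c₁ + (1 - t) * c₂) : ℝ) : EReal) ≤ epiComb ψ₁ ψ₂ t h0 h1 z := by
  refine le_iInf fun w => ?_
  have h1' : 0 < 1 - t := sub_pos.2 h1
  have e : inner ℝ q z - (t * c₁ + (1 - t) * c₂)
      = t * (inner ℝ q (t⁻¹ • (z - w)) - c₁) + (1 - t) * (inner ℝ q ((1 - t)⁻¹ • w) - c₂) := by
    rw [real_inner_smul_right, real_inner_smul_right, inner_sub_right]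
    field_simp
    ring
  rw [e, EReal.coe_add, EReal.coe_mul, EReal.coe_mul]
  exact add_le_add (mul_le_mul_of_nonneg_left (hψ₁ _) (EReal.coe_nonneg.2 h0.le))
    (mul_le_mul_of_nonneg_left (hψ₂ _) (EReal.coe_nonneg.2 h1'.le))

/-- The other half: lower bounds for conjugates, in the form of witnesses. The convex combination of
the two witnesses is a witness for the epi-combination. -/
theorem exists_epiComb_le_inner_sub {ψ₁ ψ₂ : ConvC n} {t : ℝ} {h0 : 0 < t} {h1 : t < 1}
    {q : EuclideanSpace ℝ (Fin n)} {c₁ c₂ : ℝ}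
    (hψ₁ : ∃ z, ψ₁ z ≤ ((inner ℝ q z - c₁ : ℝ) : EReal))
    (hψ₂ : ∃ z, ψ₂ z ≤ ((inner ℝ q z - c₂ : ℝ) : EReal)) :
    ∃ z, epiComb ψ₁ ψ₂ t h0 h1 z ≤ ((inner ℝ q z - (t * c₁ + (1 - t) * c₂) : ℝ) : EReal) := by
  obtain ⟨z₁, hz₁⟩ := hψ₁
  obtain ⟨z₂, hz₂⟩ := hψ₂
  have h1' : 0 < 1 - t := sub_pos.2 h1
  refine ⟨t • z₁ + (1 - t) • z₂, (iInf_le _ ((1 - t) • z₂)).trans ?_⟩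
  have e : inner ℝ q (t • z₁ + (1 - t) • z₂) - (t * c₁ + (1 - t) * c₂)
      = t * (inner ℝ q z₁ - c₁) + (1 - t) * (inner ℝ q z₂ - c₂) := by
    rw [inner_add_right, real_inner_smul_right, real_inner_smul_right]
    ring
  rw [e, EReal.coe_add, EReal.coe_mul, EReal.coe_mul, add_sub_cancel_right]
  change (t : EReal) * ψ₁ (t⁻¹ • t • z₁) + ((1 - t : ℝ) : EReal) * ψ₂ ((1 - t)⁻¹ • (1 - t) • z₂) ≤ _
  rw [inv_smul_smul₀ h0.ne', inv_smul_smul₀ h1'.ne']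
  exact add_le_add (mul_le_mul_of_nonneg_left hz₁ (EReal.coe_nonneg.2 h0.le))
    (mul_le_mul_of_nonneg_left hz₂ (EReal.coe_nonneg.2 h1'.le))

theorem average_weight_pos (N : ℕ) : (0 : ℝ) < (N + 1) / (N + 2) := by positivity

theorem average_weight_lt_one (N : ℕ) : ((N : ℝ) + 1) / (N + 2) < 1 := by
  rw [div_lt_one (by positivity)]
  linarith

/-- The epi-average of the first `N + 1` members of a sequence of functions. -/
noncomputable def epiAverage (ψ : ℕ → ConvC n) : ℕ → ConvC n
  | 0 => ψ 0
  -- The old average already comprises `N + 1` functions; with this weight all `N + 2` count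
  -- equally.
  | N + 1 => epiComb (epiAverage ψ N) (ψ (N + 1)) ((N + 1) / (N + 2)) (average_weight_pos N)
      (average_weight_lt_one N)

theorem average_succ (c : ℕ → ℝ) (N : ℕ) :
    ((N : ℝ) + 1) / (N + 2) * ((∑ j ∈ Finset.range (N + 1), c j) / ((N + 1 : ℕ) : ℝ))
      + (1 - ((N : ℝ) + 1) / (N + 2)) * c (N + 1)
      = (∑ j ∈ Finset.range (N + 1 + 1), c j) / ((N + 1 + 1 : ℕ) : ℝ) := by
  rw [Finset.sum_range_succ _ (N + 1)]
  have h1 : (N : ℝ) + 1 ≠ 0 := by positivity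
  have h2 : (N : ℝ) + 2 ≠ 0 := by positivity
  have h3 : ((N + 1 + 1 : ℕ) : ℝ) = N + 2 := by push_cast; ring
  rw [h3]
  push_cast
  field_simp
  ring

theorem inner_sub_le_epiAverage {ψ : ℕ → ConvC n} {q : EuclideanSpace ℝ (Fin n)} {c : ℕ → ℝ}
    (h : ∀ j z, ((inner ℝ q z - c j : ℝ) : EReal) ≤ ψ j z) (N : ℕ) :
    ∀ z, ((inner ℝ q z - (∑ j ∈ Finset.range (N + 1), c j) / ((N + 1 : ℕ) : ℝ) : ℝ) : EReal)
      ≤ epiAverage ψ N z := by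
  induction N with
  | zero => simpa [epiAverage] using h 0
  | succ N ih =>
    rw [← average_succ]
    exact inner_sub_le_epiComb ih (h (N + 1))

theorem exists_epiAverage_le_inner_sub {ψ : ℕ → ConvC n} {q : EuclideanSpace ℝ (Fin n)}
    {c : ℕ → ℝ} (h : ∀ j, ∃ z, ψ j z ≤ ((inner ℝ q z - c j : ℝ) : EReal)) (N : ℕ) :
    ∃ z, epiAverage ψ N z
      ≤ ((inner ℝ q z - (∑ j ∈ Finset.range (N + 1), c j) / ((N + 1 : ℕ) : ℝ) : ℝ) : EReal) := by
  induction N with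
  | zero => simpa [epiAverage] using h 0
  | succ N ih =>
    rw [← average_succ]
    exact exists_epiComb_le_inner_sub ih (h (N + 1))

/-- The only place where convexity of `Ψ` enters part (a). -/
theorem IsConvexFunctional.epiAverage_le {Ψ : ConvC n → EReal} (hΨ : IsConvexFunctional Ψ)
    {ψ : ℕ → ConvC n} {c : EReal} (h : ∀ j, Ψ (ψ j) ≤ c) (N : ℕ) : Ψ (epiAverage ψ N) ≤ c := by
  induction N with
  | zero => exact h 0
  | succ N ih =>
    have h0 := average_weight_pos N
    have h1 := average_weight_lt_one N
    refine (hΨ (epiAverage ψ N) (ψ (N + 1)) _ h0 h1).trans ?_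
    refine le_trans (add_le_add (mul_le_mul_of_nonneg_left ih (EReal.coe_nonneg.2 h0.le))
      (mul_le_mul_of_nonneg_left (h (N + 1)) (EReal.coe_nonneg.2 (sub_pos.2 h1).le)))
      (EReal.coe_mul_add_coe_one_sub_mul h0 h1 c).le

/-! ### Separation from a ball -/

open Classical in
/-- The convex indicator function of the closed ball of radius `ε` around the origin. -/
noncomputable def ballIndicator (n : ℕ) (ε : ℝ) (hε : 0 ≤ ε) : ConvC n where
  toFun z := if ‖z‖ ≤ ε then 0 else ⊤
  ne_bot' z := by split_ifs <;> simp
  convex' x y t h0 h1 := by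
    have h1' : 0 < 1 - t := sub_pos.2 h1
    by_cases hx : ‖x‖ ≤ ε
    · by_cases hy : ‖y‖ ≤ ε
      · have : ‖t • x + (1 - t) • y‖ ≤ ε := by
          have := convex_closedBall (0 : EuclideanSpace ℝ (Fin n)) ε (by simpa using hx)
            (by simpa using hy) h0.le h1'.le (by ring)
          simpa using this
        simp [hx, hy, this]
      · simp only [hx, hy, if_true, if_false, mul_zero, EReal.coe_mul_top_of_pos h1', zero_add,
          le_top]
    · rw [if_neg hx, EReal.coe_mul_top_of_pos h0, EReal.top_add_of_ne_bot]
      · exact le_top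
      · split_ifs
        · simp
        · rw [EReal.coe_mul_top_of_pos h1']; simp
  coercive' := by
    refine tendsto_const_nhds.congr' ?_
    have h := (tendsto_norm_cobounded_atTop (E := EuclideanSpace ℝ (Fin n))).eventually
      (eventually_gt_atTop ε)
    filter_upwards [h] with x hx
    rw [if_neg (not_le.2 hx)]
  proper' := ⟨0, by simp [hε]⟩
  lsc' := by
    intro x a ha
    by_cases hx : ‖x‖ ≤ ε
    · simp only [hx, if_true] at ha
      refine Eventually.of_forall fun z => ?_
      dsimp only
      split_ifs
      · exact ha
      · exact ha.trans (by simp)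
    · simp only [hx, if_false] at ha
      have : ∀ᶠ z in 𝓝 x, ε < ‖z‖ := continuous_norm.continuousAt.eventually
        (lt_mem_nhds (not_le.1 hx))
      filter_upwards [this] with z hz
      rwa [if_neg (not_le.2 hz)]

/-- If a function in `ConvC n` exceeds `a` on the closed ball of radius `ε` around `x`, then it
has an affine minorant that exceeds `a` on the whole ball. -/
theorem exists_affine_minorant_of_forall_ball (ψ : ConvC n) {x : EuclideanSpace ℝ (Fin n)}
    {ε a : ℝ} (hε : 0 < ε) (h : ∀ z, ‖z - x‖ ≤ ε → (a : EReal) < ψ z) :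
    ∃ (p : EuclideanSpace ℝ (Fin n)) (c : ℝ), a < inner ℝ p x + c ∧
      ∀ z, ((inner ℝ p z + ε * ‖p‖ + c : ℝ) : EReal) ≤ ψ z := by
  -- `χ` takes the infimum of `ψ` over balls of radius `ε`. The infimum is attained, so the strict
  -- bound survives at `x`.
  set χ := ψ.epiSum (ballIndicator n ε hε.le) with hχ
  have hx : (a : EReal) < χ x := by
    obtain ⟨y, hy⟩ := infConv_attained ψ (ballIndicator n ε hε.le) x
    change (a : EReal) < infConv ψ (ballIndicator n ε hε.le) x
    rw [hy]
    by_cases hy' : ‖y‖ ≤ ε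
    · have : ballIndicator n ε hε.le y = 0 := if_pos hy'
      rw [this, add_zero]
      exact h _ (by simpa using hy')
    · have : ballIndicator n ε hε.le y = ⊤ := if_neg hy'
      rw [this, EReal.add_top_of_ne_bot (ψ.ne_bot' _)]
      exact EReal.coe_lt_top a
  obtain ⟨m, hm⟩ := χ.exists_real_le
  obtain ⟨p, c, hp, ha⟩ := exists_affine_minorant_gt χ.convex' χ.lsc'
    ⟨0, m, by simpa using hm⟩ hx
  refine ⟨p, c, ha, fun z => ?_⟩
  -- `w` maximizes `⟨p, ·⟩` on the ball, which yields the gain `ε * ‖p‖`; for `p = 0` division by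
  -- zero gives `w = 0`.
  set w := (ε / ‖p‖) • p with hw
  have hwn : ‖w‖ ≤ ε := by
    rw [hw, norm_smul, Real.norm_of_nonneg (by positivity)]
    by_cases h0 : ‖p‖ = 0
    · simpa [h0] using hε.le
    · rw [div_mul_cancel₀ _ h0]
  have hwp : inner ℝ p w = ε * ‖p‖ := by
    rw [hw, real_inner_smul_right, real_inner_self_eq_norm_sq]
    by_cases h0 : ‖p‖ = 0
    · simp [h0]
    · field_simp
  have h1 : χ (z + w) ≤ ψ z := by
    refine (iInf_le _ w).trans (le_of_eq ?_)
    have : ballIndicator n ε hε.le w = 0 := if_pos hwn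
    rw [this, add_zero, add_sub_cancel_right]
  have h2 := (hp (z + w)).trans h1
  rwa [inner_add_right, hwp] at h2

end ConvC

/-! ### A criterion for epi-convergence -/

section EpiConvergence

variable {n : ℕ} {ψs : ℕ → ConvC n} {φ : ConvC n}

/-- If `ψs j` exceeded `a` on the whole ball, separation would give a minorant of some slope `p`
forcing the conjugate of `ψs j` at `p` below `⟨p, x⟩ - a`. But `legendre φ p ≥ ⟨p, x⟩ - s` lies
strictly above that, and `hlow` with compactness transfers this to all `‖p‖ ≤ R` for large `j`.
Steeper slopes are reduced to norm `R` using the common lower bound `m`. -/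
theorem eventually_exists_near_le {m : ℝ} (hm : ∀ j z, (m : EReal) ≤ ψs j z)
    (hlow : ∀ p (b : ℝ), (b : EReal) < legendre φ p → ∀ᶠ jp : ℕ × EuclideanSpace ℝ (Fin n) in
      atTop ×ˢ 𝓝 p, ∃ z, ψs jp.1 z ≤ ((inner ℝ jp.2 z - b : ℝ) : EReal))
    {x : EuclideanSpace ℝ (Fin n)} {s a ε : ℝ} (hs : φ x = s) (hsa : s < a) (hε : 0 < ε) :
    ∀ᶠ j in atTop, ∃ z, ‖z - x‖ ≤ ε ∧ ψs j z ≤ a := by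
  -- Chosen so that the gain `ε * R = |a - m| + ε` beats the loss `(1 - t) * (a - m)` from mixing
  -- with the constant `m`.
  set R : ℝ := |a - m| / ε + 1 with hR
  have hR0 : 0 < R := by positivity
  have hK : ∀ᶠ j in atTop, ∀ p ∈ Metric.closedBall (0 : EuclideanSpace ℝ (Fin n)) R,
      ∃ z, ψs j z ≤ ((inner ℝ p z - (inner ℝ p x - a) : ℝ) : EReal) := by
    refine (isCompact_closedBall (0 : EuclideanSpace ℝ (Fin n)) R).induction_on
      (p := fun K => ∀ᶠ j in atTop, ∀ p ∈ K,
        ∃ z, ψs j z ≤ ((inner ℝ p z - (inner ℝ p x - a) : ℝ) : EReal)) (by simp)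
      (fun K L hKL hL => hL.mono fun j hj p hp => hj p (hKL hp))
      (fun K L hK hL => (hK.and hL).mono fun j hj p hp => hp.elim (hj.1 p) (hj.2 p))
      fun p _ => ?_
    -- Halfway between `⟨p, x⟩ - a` and `⟨p, x⟩ - s`, which leaves room to vary `p`.
    set b := inner ℝ p x - a + (a - s) / 2 with hb
    have hbL : (b : EReal) < legendre φ p := by
      refine lt_of_lt_of_le (EReal.coe_lt_coe_iff.2 (by linarith :
        b < inner ℝ p x - s)) ?_
      rw [EReal.coe_sub, ← hs]
      exact le_iSup (fun y => ((inner ℝ p y : ℝ) : EReal) - φ y) x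
    have hcont : ∀ᶠ p' in 𝓝 p, inner ℝ p' x - a < b := by
      have : Continuous fun p' : EuclideanSpace ℝ (Fin n) => inner ℝ p' x - a := by fun_prop
      exact this.continuousAt.eventually (gt_mem_nhds (by linarith))
    obtain ⟨A, hA, B, hB, hAB⟩ := eventually_prod_iff.1 (hlow p b hbL)
    refine ⟨_, mem_nhdsWithin_of_mem_nhds (hB.and hcont), ?_⟩
    filter_upwards [hA] with j hj p' hp'
    obtain ⟨z, hz⟩ := hAB hj hp'.1
    exact ⟨z, hz.trans (EReal.coe_le_coe_iff.2 (by linarith [hp'.2]))⟩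
  filter_upwards [hK] with j hj
  by_contra! hcon
  obtain ⟨p, c, ha, hp⟩ := (ψs j).exists_affine_minorant_of_forall_ball hε hcon
  rcases le_or_gt ‖p‖ R with hpR | hpR
  · obtain ⟨z, hz⟩ := hj p (by simpa using hpR)
    have h1 := EReal.coe_le_coe_iff.1 ((hp z).trans hz)
    have h2 : 0 ≤ ε * ‖p‖ := by positivity
    linarith
  · have hp0 : 0 < ‖p‖ := hR0.trans hpR
    -- The convex combination of the steep minorant and the constant `m` with weights `t` and `1 -
    -- t` has slope `t • p`, of norm `R`.
    set t := R / ‖p‖ with ht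
    have ht0 : 0 < t := by positivity
    have ht1 : t < 1 := (div_lt_one hp0).2 hpR
    have htp : t * ‖p‖ = R := div_mul_cancel₀ _ hp0.ne'
    obtain ⟨z, hz⟩ := hj (t • p) (by
      simp [norm_smul, abs_of_pos ht0, htp])
    rw [real_inner_smul_left, real_inner_smul_left] at hz
    have h1 := EReal.coe_le_coe_iff.1 ((hp z).trans hz)
    have h2 := EReal.coe_le_coe_iff.1 ((hm j z).trans hz)
    have h3 := mul_le_mul_of_nonneg_left h1 ht0.le
    have h4 := mul_le_mul_of_nonneg_left h2 (sub_pos.2 ht1).le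
    have h5 : t * (ε * ‖p‖) = |a - m| + ε := by
      rw [mul_left_comm, htp, hR]; field_simp
    have h6 := mul_lt_mul_of_pos_left ha ht0
    have h7 : (1 - t) * (a - m) ≤ |a - m| :=
      (mul_le_mul_of_nonneg_left (le_abs_self _) (sub_pos.2 ht1).le).trans
        (mul_le_of_le_one_left (abs_nonneg _) (by linarith))
    nlinarith

/-- A criterion for epi-convergence in terms of affine minorants and conjugates. -/
theorem epiConverges_of_conjugate {m : ℝ} (hm : ∀ j z, (m : EReal) ≤ ψs j z)
    (hup : ∀ x (a : ℝ), (a : EReal) < φ x → ∃ (q : EuclideanSpace ℝ (Fin n)) (c : ℝ) (cs : ℕ → ℝ),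
      a < inner ℝ q x - c ∧ Tendsto cs atTop (𝓝 c) ∧
        ∀ j z, ((inner ℝ q z - cs j : ℝ) : EReal) ≤ ψs j z)
    (hlow : ∀ p (b : ℝ), (b : EReal) < legendre φ p → ∀ᶠ jp : ℕ × EuclideanSpace ℝ (Fin n) in
      atTop ×ˢ 𝓝 p, ∃ z, ψs jp.1 z ≤ ((inner ℝ jp.2 z - b : ℝ) : EReal)) :
    EpiConverges (fun j => ψs j) φ := by
  intro x
  have hinf : ∀ u : ℕ → EuclideanSpace ℝ (Fin n), Tendsto u atTop (𝓝 x) →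
      φ x ≤ liminf (fun j => ψs j (u j)) atTop := by
    intro u hu
    refine le_of_forall_lt_imp_le_of_dense fun b hb => ?_
    obtain ⟨a, hba, ha⟩ := EReal.lt_iff_exists_real_btwn.1 hb
    obtain ⟨q, c, cs, hac, hcs, hq⟩ := hup x a ha
    refine hba.le.trans (le_liminf_of_le (by isBoundedDefault) ?_)
    have hlim : Tendsto (fun j => inner ℝ q (u j) - cs j) atTop (𝓝 (inner ℝ q x - c)) :=
      (tendsto_const_nhds.inner hu).sub hcs
    filter_upwards [hlim.eventually (lt_mem_nhds hac)] with j hj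
    exact (EReal.coe_le_coe_iff.2 hj.le).trans (hq j _)
  refine ⟨hinf, ?_⟩
  suffices h : ∃ u : ℕ → EuclideanSpace ℝ (Fin n), Tendsto u atTop (𝓝 x) ∧
      limsup (fun j => ψs j (u j)) atTop ≤ φ x by
    obtain ⟨u, hu, hsup⟩ := h
    exact ⟨u, hu, tendsto_of_le_liminf_of_limsup_le (hinf u hu) hsup⟩
  by_cases htop : φ x = ⊤
  · exact ⟨fun _ => x, tendsto_const_nhds, htop ▸ le_top⟩
  set s := (φ x).toReal with hs
  have hxs : φ x = s := (EReal.coe_toReal htop (φ.ne_bot' x)).symm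
  -- Almost nearest points to `(x, s)` in the epigraphs form a single recovery sequence, without a
  -- diagonal argument over `ε`.
  let S : ℕ → Set (EuclideanSpace ℝ (Fin n) × ℝ) := fun j => {q | ψs j q.1 ≤ (q.2 : EReal)}
  have hne : ∀ j, (S j).Nonempty := fun j => by
    obtain ⟨z, hz⟩ := (ψs j).proper'
    exact ⟨(z, (ψs j z).toReal), EReal.le_coe_toReal hz.ne⟩
  have hex : ∀ j, ∃ q ∈ S j, dist (x, s) q < Metric.infDist (x, s) (S j) + 1 / ((j : ℝ) + 1) :=
    fun j => (Metric.infDist_lt_iff (hne j)).1 (lt_add_of_pos_right _ (by positivity))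
  choose q hqS hq using hex
  have hdist : Tendsto (fun j => Metric.infDist (x, s) (S j)) atTop (𝓝 0) := by
    rw [Metric.tendsto_nhds]
    intro ε hε
    filter_upwards [eventually_exists_near_le hm hlow hxs (by linarith : s < s + ε / 2)
      (half_pos hε)] with j ⟨z, hz, hza⟩
    rw [Real.dist_0_eq_abs, abs_of_nonneg Metric.infDist_nonneg]
    refine (Metric.infDist_le_dist_of_mem (show (z, s + ε / 2) ∈ S j from hza)).trans_lt ?_
    rw [Prod.dist_eq, max_lt_iff]
    constructor
    · rw [dist_comm, dist_eq_norm]; linarith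
    · rw [Real.dist_eq]
      simp only [sub_add_cancel_left, abs_neg, abs_of_pos (half_pos hε)]
      linarith
  have hqlim : Tendsto q atTop (𝓝 (x, s)) := by
    rw [tendsto_iff_dist_tendsto_zero]
    refine squeeze_zero (fun _ => dist_nonneg) (fun j => ?_)
      (by simpa only [add_zero] using hdist.add tendsto_one_div_add_atTop_nhds_zero_nat)
    rw [dist_comm]
    exact (hq j).le
  refine ⟨fun j => (q j).1, hqlim.fst_nhds, ?_⟩
  have h2 : Tendsto (fun j => ((q j).2 : EReal)) atTop (𝓝 (s : EReal)) :=
    (continuous_coe_real_ereal.tendsto s).comp hqlim.snd_nhds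
  rw [hxs, ← h2.limsup_eq]
  exact limsup_le_limsup (Eventually.of_forall hqS)

end EpiConvergence

/-! ### Random rotations and the inequality of part (a) -/

/-- The rotational epi-symmetrization is the epi-limit of epi-averages of rotations. -/
theorem exists_epiConverges_epiAverage_rotate {n : ℕ} {ψ φ : ConvC n}
    (h : IsRotEpiSymmetrization ψ φ) :
    ∃ ϑ : ℕ → SO n,
      EpiConverges (fun j => ConvC.epiAverage (fun i => ψ.rotate (ϑ i)) j) φ := by
  obtain ⟨y, r, hyr, hL⟩ := exists_seq_legendre_eq ψ.ne_bot' ψ.proper'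
  have hbot : ∀ p, legendre ψ p ≠ ⊥ := fun p => by
    refine ne_bot_of_le_ne_bot (EReal.coe_ne_bot (inner ℝ p (y 0) - r 0)) ?_
    rw [hL]
    exact le_iSup (fun i => ((inner ℝ p (y i) - r i : ℝ) : EReal)) 0
  have hbotφ : ∀ p, legendre φ p ≠ ⊥ := fun p => by
    refine ne_bot_of_le_ne_bot (EReal.coe_ne_bot (rotMaxAffine y r 0 p)) ?_
    rw [h p, erealIntegral_legendre_act hL]
    exact le_iSup (fun k => (rotMaxAffine y r k p : EReal)) 0
  have htopφ : ∃ p, legendre φ p < ⊤ := by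
    obtain ⟨m, hm⟩ := φ.exists_real_le
    have h0 : legendre φ 0 ≤ ((-m : ℝ) : EReal) :=
      legendre_le_coe_iff.2 fun z => by simpa using hm z
    exact ⟨0, h0.trans_lt (EReal.coe_lt_top _)⟩
  -- Applied to `legendre φ`, this writes `φ` as the supremum of affine functions with countably
  -- many slopes `Y i`, at which `legendre φ` has the finite values `R i`.
  obtain ⟨Y, R, hYR, hφ⟩ := exists_seq_legendre_eq hbotφ htopφ
  rw [φ.legendre_legendre] at hφ
  have hmeas : ∀ p, Measurable fun ϑ : SO n => legendre ψ (SO.act ϑ⁻¹ p) := fun p => by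
    simp only [hL, ← iSup_maxAffine]
    exact Measurable.iSup fun k => (continuous_maxAffine_act k p).measurable.coe_real_ereal
  have hY : ∀ i, (∀ᵐ ϑ ∂(SO.haar n), legendre ψ (SO.act ϑ⁻¹ (Y i)) ≠ ⊤) ∧
      Integrable (fun ϑ : SO n => (legendre ψ (SO.act ϑ⁻¹ (Y i))).toReal) (SO.haar n) ∧
      ∫ ϑ, (legendre ψ (SO.act ϑ⁻¹ (Y i))).toReal ∂(SO.haar n) = R i := fun i =>
    integrable_toReal_of_erealIntegral_eq_coe (hmeas _) (fun _ => hbot _) ((h (Y i)).symm.trans (hYR i))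
  let D : ℕ → EuclideanSpace ℝ (Fin n) := TopologicalSpace.denseSeq _
  -- The first family bounds the conjugates of the epi-averages from above at the `Y i`; the second,
  -- at dense points, bounds them from below.
  let F : ℕ ⊕ (ℕ × ℕ) → SO n → ℝ := Sum.elim
    (fun i ϑ => (legendre ψ (SO.act ϑ⁻¹ (Y i))).toReal)
    fun kd ϑ => maxAffine y r kd.1 (SO.act ϑ⁻¹ (D kd.2))
  have hFm : ∀ i, Measurable (F i) := by
    rintro (i | kd)
    · exact (hmeas _).ereal_toReal
    · exact (continuous_maxAffine_act _ _).measurable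
  have hFi : ∀ i, Integrable (F i) (SO.haar n) := by
    rintro (i | kd)
    · exact (hY i).2.1
    · exact SO.integrable_of_continuous (continuous_maxAffine_act _ _)
  obtain ⟨ϑ, hfin, hlim⟩ := exists_seq_tendsto_average hFm hFi (ae_all_iff.2 fun i => (hY i).1)
  -- The shift is needed because `epiAverage` with index `N` has `N + 1` members.
  have hlim' := fun i => (tendsto_add_atTop_iff_nat 1).2 (hlim i)
  refine ⟨ϑ, ?_⟩
  obtain ⟨m, hm⟩ := ψ.exists_real_le
  refine epiConverges_of_conjugate (m := m) (fun j z => ?_) (fun x a ha => ?_) fun p b hb => ?_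
  · have := ConvC.inner_sub_le_epiAverage (ψ := fun i => ψ.rotate (ϑ i)) (q := 0)
      (c := fun _ => -m) (fun i z => by
        rw [inner_zero_left, zero_sub, neg_neg]
        exact hm (SO.act (ϑ i)⁻¹ z)) j z
    refine le_trans (EReal.coe_le_coe_iff.2 (le_of_eq ?_)) this
    have : ((j : ℝ) + 1) ≠ 0 := by positivity
    simp
    field_simp
  · rw [hφ x, lt_iSup_iff] at ha
    obtain ⟨i, hi⟩ := ha
    rw [EReal.coe_lt_coe_iff, real_inner_comm] at hi
    have hl := hlim' (Sum.inl i)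
    rw [show ∫ x, F (Sum.inl i) x ∂(SO.haar n) = R i from (hY i).2.2] at hl
    refine ⟨Y i, R i, _, hi, hl, fun j => ConvC.inner_sub_le_epiAverage (fun l z => ?_) j⟩
    have := legendre_le_coe_iff.1 (EReal.le_coe_toReal (hfin l i)) (SO.act (ϑ l)⁻¹ z)
    rwa [SO.inner_act_inv, SO.act_act_inv] at this
  · rw [h p, erealIntegral_legendre_act hL, lt_iSup_iff] at hb
    obtain ⟨k, hk⟩ := hb
    rw [EReal.coe_lt_coe_iff] at hk
    obtain ⟨M, hM0, hM⟩ := exists_maxAffine_lipschitz y r k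
    set η := rotMaxAffine y r k p - b with hη
    have hη0 : 0 < η := sub_pos.2 hk
    -- The gap `η` is spent as follows: `η / 4` on replacing `p` by `D d` in the mean, `η / 4` on
    -- the law of large numbers, and `η / 2` on passing from `D d` to any `p'` within `δ` of `p`.
    set δ := η / (4 * M) with hδ
    have hδ0 : 0 < δ := by positivity
    have hMδ : M * δ = η / 4 := by rw [hδ]; field_simp
    obtain ⟨d, hd⟩ := (TopologicalSpace.denseRange_denseSeq (EuclideanSpace ℝ (Fin n))).exists_dist_lt
      p hδ0
    change dist p (D d) < δ at hd
    rw [dist_eq_norm] at hd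
    have hl := hlim' (Sum.inr (k, d))
    have hev := hl.eventually (lt_mem_nhds (sub_lt_self _ (by positivity : 0 < η / 4)))
    change ∀ᶠ N in atTop, rotMaxAffine y r k (D d) - η / 4 < _ at hev
    have h1 := rotMaxAffine_le_add hM p (D d)
    have h2 : M * ‖p - D d‖ ≤ M * δ := mul_le_mul_of_nonneg_left hd.le hM0.le
    refine (hev.prod_mk (Metric.ball_mem_nhds p hδ0)).mono ?_
    rintro ⟨N, p'⟩ ⟨hN, hp'⟩
    dsimp only at hN hp' ⊢
    have hp'd : ‖D d - p'‖ ≤ 2 * δ := by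
      rw [dist_eq_norm, norm_sub_rev] at hp'
      have := norm_sub_le_norm_sub_add_norm_sub (D d) p p'
      rw [norm_sub_rev (D d) p] at this
      linarith
    have hMd : M * ‖D d - p'‖ ≤ M * (2 * δ) := mul_le_mul_of_nonneg_left hp'd hM0.le
    obtain ⟨z, hz⟩ := ConvC.exists_epiAverage_le_inner_sub (ψ := fun i => ψ.rotate (ϑ i)) (q := p')
      (c := fun l => F (Sum.inr (k, d)) (ϑ l) - η / 2) (fun l => by
        obtain ⟨i, -, hi⟩ := exists_maxAffine_eq (y := y) (r := r) k (SO.act (ϑ l)⁻¹ p')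
        have h3 := hM (SO.act (ϑ l)⁻¹ (D d)) (SO.act (ϑ l)⁻¹ p')
        rw [← map_sub, SO.norm_act] at h3
        -- The index `i` attains the maximum at the rotated `p'`, so the rotated `y i` is the
        -- witness for the rotated function.
        refine ⟨SO.act (ϑ l) (y i), ?_⟩
        change ψ (SO.act (ϑ l)⁻¹ (SO.act (ϑ l) (y i))) ≤ _
        rw [SO.act_inv_act, hyr i, EReal.coe_le_coe_iff, ← SO.inner_act_inv]
        change _ ≤ _ - (maxAffine y r k (SO.act (ϑ l)⁻¹ (D d)) - η / 2)
        linarith) N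
    refine ⟨z, hz.trans (EReal.coe_le_coe_iff.2 ?_)⟩
    have hN0 : ((N + 1 : ℕ) : ℝ) ≠ 0 := by positivity
    rw [Finset.sum_sub_distrib, Finset.sum_const, Finset.card_range, nsmul_eq_mul, sub_div,
      mul_div_cancel_left₀ _ hN0]
    linarith

theorem ConvC.apply_le_of_isRotEpiSymmetrization {n : ℕ} {Ψ : ConvC n → EReal}
    (hlsc : IsEpiLowerSemicontinuous Ψ) (hconv : IsConvexFunctional Ψ)
    (hrot : IsRotationInvariant Ψ) {ψ φ : ConvC n} (h : IsRotEpiSymmetrization ψ φ) :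
    Ψ φ ≤ Ψ ψ := by
  obtain ⟨ϑ, hϑ⟩ := exists_epiConverges_epiAverage_rotate h
  refine (hlsc _ _ hϑ).trans ?_
  refine (liminf_le_liminf (Eventually.of_forall fun j =>
    hconv.epiAverage_le (fun i => (hrot ψ (ϑ i)).le) j)).trans_eq ?_
  exact liminf_const _

/-! ### Dimension one and the conclusion -/

/-- Epi-multiplication distributes over the epi-sum: rescale the variable of the infimum by `1 / 2`.
This puts `ψ.rotOne` in the form to which convexity of `Ψ` applies. -/
theorem ConvC.rotOne_eq (ψ : ConvC 1) :
    ψ.rotOne = epiComb ψ ψ.reflect (1 / 2) (by norm_num) (by norm_num) := by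
  have e : ∀ z, epiComb ψ ψ.reflect (1 / 2) (by norm_num) (by norm_num) z
      = ⨅ y, (((1 / 2 : ℝ) : EReal) * ψ ((1 / 2 : ℝ)⁻¹ • (z - y))
        + ((1 / 2 : ℝ) : EReal) * ψ.reflect ((1 / 2 : ℝ)⁻¹ • y)) := by
    intro z
    have h : (1 - 1 / 2 : ℝ) = 1 / 2 := by norm_num
    change (⨅ y, (((1 / 2 : ℝ) : EReal) * ψ ((1 / 2 : ℝ)⁻¹ • (z - y))
        + ((1 - 1 / 2 : ℝ) : EReal) * ψ.reflect ((1 - 1 / 2 : ℝ)⁻¹ • y))) = _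
    rw [h]
  have h0 : (0 : EReal) ≤ ((1 / 2 : ℝ) : EReal) := EReal.coe_nonneg.2 (by norm_num)
  apply ConvC.ext
  ext z
  rw [e]
  change ((1 / 2 : ℝ) : EReal) * infConv ψ ψ.reflect ((1 / 2 : ℝ)⁻¹ • z) = _
  refine le_antisymm (le_iInf fun y => ?_) ?_
  · rw [← EReal.left_distrib_of_nonneg_of_ne_top h0 (EReal.coe_ne_top _)]
    refine mul_le_mul_of_nonneg_left ((iInf_le _ ((1 / 2 : ℝ)⁻¹ • y)).trans_eq ?_) h0
    rw [smul_sub]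
  · obtain ⟨y, hy⟩ := infConv_attained ψ ψ.reflect ((1 / 2 : ℝ)⁻¹ • z)
    refine (iInf_le _ ((1 / 2 : ℝ) • y)).trans_eq ?_
    rw [hy, EReal.left_distrib_of_nonneg_of_ne_top h0 (EReal.coe_ne_top _), smul_sub,
      inv_smul_smul₀ (by norm_num)]

theorem ConvC.apply_rotOne_le {Ψ : ConvC 1 → EReal} (hconv : IsConvexFunctional Ψ)
    (hrefl : IsReflectionInvariant Ψ) (ψ : ConvC 1) : Ψ ψ.rotOne ≤ Ψ ψ := by
  rw [rotOne_eq]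
  refine (hconv ψ ψ.reflect (1 / 2) (by norm_num) (by norm_num)).trans_eq ?_
  rw [hrefl]
  exact EReal.coe_mul_add_coe_one_sub_mul (by norm_num) (by norm_num) _

theorem theorem2p1 :
    (∀ n : ℕ, 2 ≤ n →
      (∀ ψ : ConvC n, ∃! φ : ConvC n, IsRotEpiSymmetrization ψ φ) ∧
      ∀ Ψ : ConvC n → EReal, ConvC.IsAdmissible Ψ → ConvC.IsEpiLowerSemicontinuous Ψ →
        ConvC.IsConvexFunctional Ψ → ConvC.IsRotationInvariant Ψ →
        ∀ ψ ψrot : ConvC n, IsRotEpiSymmetrization ψ ψrot → Ψ ψrot ≤ Ψ ψ) ∧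
    (∀ Ψ : ConvC 1 → EReal, ConvC.IsAdmissible Ψ →
      ConvC.IsConvexFunctional Ψ → ConvC.IsReflectionInvariant Ψ →
      ∀ ψ : ConvC 1, Ψ ψ.rotOne ≤ Ψ ψ) := by
  exact ⟨fun n _ => ⟨existsUnique_isRotEpiSymmetrization, fun _ _ hlsc hconv hrot _ _ h =>
    ConvC.apply_le_of_isRotEpiSymmetrization hlsc hconv hrot h⟩,
    fun _ _ hconv hrefl => ConvC.apply_rotOne_le hconv hrefl⟩
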